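/- An origami (square-tiled surface) is a closed connected surface $X$ obtained from finitely many unit squares by gluing, via translations, each right side to a left side and each top side to a bottom side. It comes with a cover $\pi\colon X\to\mathbb{T}=\mathbb{R}^2/\mathbb{Z}^2$ branched at most over the origin and with the abelian differential $\omega=\pi^*\mathrm{d}z$, which has a zero of order $m$ at a point exactly when the total angle around that point is $2\pi(m+1)$. The origami is regular if $\pi$ is a normal cover. Its translation group is the group of automorphisms $f$ of $X$ with $f^*\omega=\omega$. For $k \ge 1$, it lies in the stratum $\mathcal{H}(k^{s})$ if $\omega$ has exactly $s$ zeros, all of order $k$. Let $k\geq 1$ be an odd integer and let $q$ be an odd prime. Then regular origamis exist in the stratum $\mathcal{H}(k^{2q})$ if and only if $q=3$ and either: - $k\equiv 1 \pmod 4$ and every prime factor of $(k+1)/2$ is congruent to $1$ modulo $3$; or - $k\equiv 3 \pmod 4$ and every prime factor of $(k+1)/4$ is congruent to $1$ modulo $3$. Moreover, the translation group of any regular origami in $\mathcal{H}(k^{2q})$ is isomorphic to a semidirect product $(\mathbb{Z}/\lambda\mathbb{Z}\times\mathbb{Z}/2\mathbb{Z}\times\mathbb{Z}/2\mathbb{Z})\rtimes\mathbb{Z}/3\mathbb{Z}$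 with $\lambda=(k+1)/2$ if $k\equiv 1\pmod 4$, and to a semidirect product $(\mathbb{Z}/\lambda\mathbb{Z}\times \mathrm{Q}_8)\rtimes\mathbb{Z}/3\mathbb{Z}$ with $\lambda=(k+1)/4$ if $k\equiv 3\pmod 4$, where $\mathrm{Q}_8$ is the quaternion group of order $8$. The same holds in group-theoretic form: a group $G$ of order $2(k+1)q$ with two generators $x,y$ such that $[x,y]=xyx^{-1}y^{-1}$ has order $k+1$ exists if and only if $q=3$ and one of the two conditions above holds, and any such $G$ is isomorphic to a semidirect product of the first form if $k\equiv 1\pmod 4$, and of the second form if $k\equiv 3\pmod 4$. -/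

import Mathlib

universe u

/-- The data of a square-tiled surface (origami): one unit square for each element of `S`.
The right side of the square `s` is glued by a translation to the left side of `right s`, and its
top side to the bottom side of `up s`; the result has to be connected. -/
structure Origami (S : Type u) where
  right : Equiv.Perm S
  up : Equiv.Perm S
  nonempty : Nonempty S
  connected : ∀ s t : S, ∃ g ∈ Subgroup.closure {right, up}, g s = t

namespace Origami

variable {S : Type u}

/-- The disjoint union of the unit squares `[0,1] × [0,1]` indexed by `S`. -/
abbrev Squares (S : Type u) : Type u := (_ : S) × (unitInterval × unitInterval)

/-- The side identifications. -/
inductive Glue (O : Origami S) : Squares S → Squares S → Prop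
  | right (s : S) (t : unitInterval) : Glue O ⟨s, (1, t)⟩ ⟨O.right s, (0, t)⟩
  | up (s : S) (t : unitInterval) : Glue O ⟨s, (t, 1)⟩ ⟨O.up s, (t, 0)⟩

/-- The closed surface obtained from the squares by the side identifications. -/
def Surface (O : Origami S) : Type u := Quot O.Glue

instance (O : Origami S) : TopologicalSpace O.Surface :=
  inferInstanceAs (TopologicalSpace (Quot O.Glue))

/-- The unit square torus `ℝ² / ℤ²`. -/
abbrev Torus : Type := UnitAddCircle × UnitAddCircle

/-- The cover of the unit torus, branched at most over the origin. The abelian differential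
of the origami is the pull-back of `dz` under it. -/
def proj (O : Origami S) : O.Surface → Torus :=
  Quot.lift (fun p => (((p.2.1 : ℝ) : UnitAddCircle), ((p.2.2 : ℝ) : UnitAddCircle))) (by
    have h : ((1 : ℝ) : UnitAddCircle) = 0 := AddCircle.coe_period 1
    intro a b hab
    cases hab <;> simp [h])

open Classical in
/-- The angle that the unit square fills at its point `z`: `2π` at an interior point, `π` at an
interior point of a side, `π / 2` at a corner. -/
noncomputable def squareAngle (z : unitInterval × unitInterval) : ℝ :=
  2 * Real.pi * (if z.1 = 0 ∨ z.1 = 1 then 1 / 2 else 1) * (if z.2 = 0 ∨ z.2 = 1 then 1 / 2 else 1)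

/-- The total angle of the flat metric around a point of the surface. -/
noncomputable def coneAngle (O : Origami S) (P : O.Surface) : ℝ :=
  ∑ᶠ a ∈ {a : Squares S | Quot.mk O.Glue a = P}, squareAngle a.2

/-- The differential has a zero of order `m` at `P` if and only if the total angle around `P`
is `2π (m + 1)`; order `0` means that it does not vanish at `P`. -/
def HasOrder (O : Origami S) (P : O.Surface) (m : ℕ) : Prop :=
  O.coneAngle P = 2 * Real.pi * (m + 1)

/-- The origami lies in the stratum `H(k ^ n)` (for `k ≥ 1`): its differential has exactly `n`
zeros, all of them of order `k`. -/
def InStratum (O : Origami S) (k n : ℕ) : Prop :=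
  {P : O.Surface | ¬ O.HasOrder P 0}.Finite ∧
  {P : O.Surface | ¬ O.HasOrder P 0}.ncard = n ∧
  ∀ P : O.Surface, ¬ O.HasOrder P 0 → O.HasOrder P k

/-- The origami is regular: its cover of the unit torus is normal, that is, deck transformations
act transitively on the fibres. -/
def IsRegular (O : Origami S) : Prop :=
  ∀ P Q : O.Surface, O.proj P = O.proj Q →
    ∃ f : O.Surface ≃ₜ O.Surface, (∀ R, O.proj (f R) = O.proj R) ∧ f P = Q

/-- The translation group of the origami: the automorphisms `f` of the surface with `f^* ω = ω`.
As `ω` is the pull-back of `dz` under `proj`, these are the self-homeomorphisms `f` for which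
`proj ∘ f - proj` is locally constant, that is, which are translations in the flat coordinates. -/
def trans (O : Origami S) : Subgroup (O.Surface ≃ₜ O.Surface) where
  carrier := {f | IsLocallyConstant fun P => O.proj (f P) - O.proj P}
  one_mem' := by
    have : (fun P => O.proj ((1 : O.Surface ≃ₜ O.Surface) P) - O.proj P) = fun _ => 0 := by
      funext P
      exact sub_self _
    rw [Set.mem_ofPred_eq, this]
    exact IsLocallyConstant.const 0
  mul_mem' := by
    intro f g hf hg
    have : (fun P => O.proj ((f * g) P) - O.proj P) =
        ((fun P => O.proj (f P) - O.proj P) ∘ g) + fun P => O.proj (g P) - O.proj P := by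
      funext P
      exact (sub_add_sub_cancel _ _ _).symm
    rw [Set.mem_ofPred_eq, this]
    exact (hf.comp_continuous g.continuous).add hg
  inv_mem' := by
    intro f hf
    have : (fun P => O.proj (f⁻¹ P) - O.proj P) =
        -((fun P => O.proj (f P) - O.proj P) ∘ (f⁻¹ : O.Surface ≃ₜ O.Surface)) := by
      funext P
      have h : f (f⁻¹ P) = P := f.apply_symm_apply P
      simp only [Pi.neg_apply, Function.comp_apply, h, neg_sub]
    rw [Set.mem_ofPred_eq, this]
    exact (hf.comp_continuous (f⁻¹ : O.Surface ≃ₜ O.Surface).continuous).neg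

end Origami

/-- `G` is isomorphic to a semidirect product `(ℤ/l × ℤ/2 × ℤ/2) ⋊ ℤ/3`. -/
def IsKleinType (l : ℕ) (G : Type u) [Group G] : Prop :=
  ∃ φ : Multiplicative (ZMod 3) →*
      MulAut (Multiplicative (ZMod l) × Multiplicative (ZMod 2) × Multiplicative (ZMod 2)),
    Nonempty (G ≃* (Multiplicative (ZMod l) × Multiplicative (ZMod 2) × Multiplicative (ZMod 2))
      ⋊[φ] Multiplicative (ZMod 3))

/-- `G` is isomorphic to a semidirect product `(ℤ/l × Q₈) ⋊ ℤ/3`. -/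
def IsQuaternionType (l : ℕ) (G : Type u) [Group G] : Prop :=
  ∃ φ : Multiplicative (ZMod 3) →* MulAut (Multiplicative (ZMod l) × QuaternionGroup 2),
    Nonempty (G ≃* (Multiplicative (ZMod l) × QuaternionGroup 2) ⋊[φ] Multiplicative (ZMod 3))

/-- The group `G` is generated by `x` and `y`, has order `2 (k + 1) q`, and the commutator
`x y x⁻¹ y⁻¹` has order `k + 1`. -/
def IsAdmissible (k q : ℕ) (G : Type u) [Group G] (x y : G) : Prop :=
  Nat.card G = 2 * (k + 1) * q ∧ Subgroup.closure {x, y} = ⊤ ∧ orderOf (x * y * x⁻¹ * y⁻¹) = k + 1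

/-- The numerical condition on `k` and `q`. -/
def ArithCondition (k q : ℕ) : Prop :=
  q = 3 ∧
    ((k % 4 = 1 ∧ ∀ p : ℕ, p.Prime → p ∣ (k + 1) / 2 → p % 3 = 1) ∨
      (k % 4 = 3 ∧ ∀ p : ℕ, p.Prime → p ∣ (k + 1) / 4 → p % 3 = 1))

/-
The squares of a regular origami form a torsor under the group `G` of those permutations of the
squares that commute with the moves to the right and up. `G` is the deck group. If some vertex is
shared by several squares, every translation belongs to `G`: a translation that is no deck
transformation would carry this vertex to a regular point. The two moves are right multiplications
by generators `x` and `y`, and the vertices are the cosets of a conjugate of `⟨[x, y]⟩`. So the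
origami lies in `H(k ^ (2q))` exactly if `G` has order `2 (k + 1) q` and `c = [x, y]` has order
`k + 1`.

Let `G` be such a group with derived subgroup `G'`. Then `⟨c⟩` has index `2q`, so `G / G'` has
squarefree order and is cyclic, and a cyclic `G / G'` forces that `G'` has no characteristic
subgroup of index two. Signs of permutations show that `q` is the index of `G'` and two the index of
`⟨c⟩` in it, the perfect case being excluded by counting Sylow `q`-subgroups. An element `t` outside
`G'` permutes the three involutions of the four-group `G' / ⟨c ^ 2⟩` transitively, so `q = 3`. The
odd part of `⟨c⟩` is central in `G'` with a four-group or `Q₈` as a complement. On this odd part,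
of order `λ`, conjugation by `t` is raising to some power `r` with `r ^ 3 = 1`, and `r - 1` is
invertible modulo `λ`, so each prime factor of `λ` is `1` modulo `3`. Conversely, a root of
`r ^ 2 + r + 1` modulo `λ` and an automorphism of order three of the four-group or of `Q₈` define
the semidirect product.
-/

/-! ### Signs of permutations and cyclic quotients -/

section Sign

open Equiv.Perm Subgroup

theorem exists_card_support_eq_mul_and_sign_eq {X : Type*} [Fintype X] [DecidableEq X]
    (σ : Equiv.Perm X) {n : ℕ} (hn : Even n) (hσ : σ ^ n = 1)
    (hfree : ∀ x, σ x ≠ x → ∀ j : ℕ, (σ ^ j) x = x → n ∣ j) :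
    ∃ r, σ.support.card = r * n ∧ sign σ = (-1) ^ r := by
  have length_eq : ∀ l ∈ σ.cycleType, l = n := by
    intro l hl
    refine Nat.dvd_antisymm ((dvd_of_mem_cycleType hl).trans (orderOf_dvd_of_pow_eq_one hσ)) ?_
    obtain ⟨c, τ, rfl, hd, hc, rfl⟩ := mem_cycleType_iff.1 hl
    obtain ⟨x, hx⟩ := hc.nonempty_support
    have hcx : c x ≠ x := mem_support.1 hx
    have hτx : τ x = x := (hd x).resolve_left hcx
    refine hfree x (by rwa [mul_apply, hτx]) _ ?_
    rw [hd.commute.mul_pow, ← hc.orderOf, pow_orderOf_eq_one, one_mul]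
    exact pow_apply_eq_self_of_apply_eq_self hτx _
  have hsum : σ.cycleType.sum = σ.cycleType.card * n := by
    rw [Multiset.eq_replicate_card.2 length_eq, Multiset.sum_replicate, Multiset.card_replicate,
      smul_eq_mul]
  refine ⟨σ.cycleType.card, by rw [← sum_cycleType, hsum], ?_⟩
  rw [sign_of_cycleType, hsum, pow_add, pow_mul', hn.neg_one_pow, one_pow, one_mul]

variable {G : Type*} [Group G] [Finite G]

open Classical in
/-- The sign of the left regular representation, whose kernel is a characteristic subgroup of
index at most two. -/
noncomputable def regularSign (G : Type*) [Group G] [Finite G] : G →* ℤˣ :=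
  let _ := Fintype.ofFinite G
  sign.comp (MulAction.toPermHom G G)

theorem regularSign_of_even_orderOf {c : G} (hc : Even (orderOf c)) :
    regularSign G c = (-1) ^ (zpowers c).index := by
  classical
  let _ := Fintype.ofFinite G
  have hc1 : c ≠ 1 := by
    rintro rfl
    exact Nat.not_even_one (orderOf_one (G := G) ▸ hc)
  have apply_pow (j : ℕ) (x : G) : (MulAction.toPermHom G G c ^ j) x = c ^ j * x := by
    rw [← map_pow]
    rfl
  obtain ⟨r, hr, hsign⟩ := exists_card_support_eq_mul_and_sign_eq (MulAction.toPermHom G G c) hc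
    (by rw [← map_pow, pow_orderOf_eq_one, map_one]) fun x _ j hj =>
      orderOf_dvd_of_pow_eq_one (mul_eq_right.1 ((apply_pow j x).symm.trans hj))
  have hsupp : (MulAction.toPermHom G G c).support = Finset.univ := by
    ext x
    simp [hc1]
  have hidx : (zpowers c).index = r := by
    rw [hsupp, Finset.card_univ, ← Nat.card_eq_fintype_card, ← (zpowers c).card_mul_index,
      Nat.card_zpowers, mul_comm] at hr
    exact Nat.eq_of_mul_eq_mul_right (orderOf_pos c) hr
  rw [hidx, ← hsign, regularSign, MonoidHom.comp_apply]

theorem regularSign_mulEquiv (e : G ≃* G) (g : G) : regularSign G (e g) = regularSign G g := by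
  classical
  let _ := Fintype.ofFinite G
  have conj_eq : MulAction.toPermHom G G (e g) =
      (e.toEquiv.symm.trans (MulAction.toPermHom G G g)).trans e.toEquiv := by
    ext x
    simp
  rw [regularSign, MonoidHom.comp_apply, MonoidHom.comp_apply, conj_eq]
  exact sign_symm_trans_trans _ _

theorem exists_characteristic_index_eq_two {c : G} (hc : Even (orderOf c))
    (hodd : Odd (zpowers c).index) : ∃ K : Subgroup G, K.Characteristic ∧ K.index = 2 := by
  refine ⟨(regularSign G).ker, characteristic_iff_comap_eq.2 fun e => ?_, ?_⟩
  · ext g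
    simp [MonoidHom.mem_ker, regularSign_mulEquiv]
  · have hsurj : Function.Surjective (regularSign G) := fun u => by
      obtain rfl | rfl := Int.units_eq_one_or u
      · exact ⟨1, map_one _⟩
      · exact ⟨c, by rw [regularSign_of_even_orderOf hc, hodd.neg_one_pow]⟩
    rw [index_ker, MonoidHom.range_eq_top.2 hsurj, card_top, Nat.card_eq_fintype_card]
    rfl

end Sign

section CyclicQuotient

open Subgroup

variable {G : Type*} [Group G]

theorem commutator_top_commutator_of_isCyclic_quotient [IsCyclic (G ⧸ commutator G)] :
    ⁅(⊤ : Subgroup G), commutator G⁆ = commutator G := by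
  set N := ⁅(⊤ : Subgroup G), commutator G⁆
  have hN : N ≤ commutator G := commutator_le_right _ _
  let f : G ⧸ N →* G ⧸ commutator G := QuotientGroup.map N (commutator G) (MonoidHom.id G) hN
  have hker : f.ker ≤ center (G ⧸ N) := by
    have hf : f.ker = (commutator G).map (QuotientGroup.mk' N) := by
      exact (QuotientGroup.ker_map _ _ _ _).trans (by rw [comap_id])
    rw [hf, ← commutator_top_left_eq_bot_iff_le_center,
      ← map_top_of_surjective (QuotientGroup.mk' N) (QuotientGroup.mk'_surjective N),
      ← map_commutator, QuotientGroup.map_mk'_self]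
  have hcomm := MonoidHom.isMulCommutative_of_isCyclic_of_ker_le_center f hker
  refine le_antisymm hN ?_
  rw [← QuotientGroup.ker_mk' N]
  let _ : CommGroup (G ⧸ N) := { mul_comm := hcomm.is_comm.comm }
  exact Abelianization.commutator_subset_ker (QuotientGroup.mk' N)

theorem relIndex_commutator_ne_two [IsCyclic (G ⧸ commutator G)] (N : Subgroup G) [N.Normal] :
    N.relIndex (commutator G) ≠ 2 := by
  intro h
  have hle : commutator G ≤ N := by
    rw [← commutator_top_commutator_of_isCyclic_quotient, commutator_le]
    intro g _ d hd
    have mem_iff := mul_mem_iff_of_index_two (H := N.subgroupOf (commutator G)) h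
      (a := MulAut.conjNormal g ⟨d, hd⟩) (b := ⟨d, hd⟩⁻¹)
    simp only [mem_subgroupOf, coe_mul, coe_inv, MulAut.conjNormal_apply, inv_mem_iff] at mem_iff
    exact mem_iff.2 ⟨fun hn => by simpa [mul_assoc] using ‹N.Normal›.conj_mem _ hn g⁻¹,
      fun hn => ‹N.Normal›.conj_mem _ hn g⟩
  rw [relIndex_eq_one.2 hle] at h
  exact absurd h (by decide)

theorem even_relIndex_zpowers_commutator [Finite G] [IsCyclic (G ⧸ commutator G)] {c : G}
    (hc : c ∈ commutator G) (heven : Even (orderOf c)) :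
    Even ((zpowers c).relIndex (commutator G)) := by
  rw [← Nat.not_odd_iff_even]
  intro hodd
  have hzpowers : (zpowers c).subgroupOf (commutator G) = zpowers ⟨c, hc⟩ := by
    rw [subgroupOf, ← comap_map_eq_self_of_injective (subtype_injective _) (zpowers ⟨c, hc⟩),
      MonoidHom.map_zpowers, coe_subtype]
  obtain ⟨K, hK, hidx⟩ := exists_characteristic_index_eq_two (c := (⟨c, hc⟩ : commutator G))
    (by rwa [orderOf_mk]) (by rwa [← hzpowers])
  exact relIndex_commutator_ne_two (K.map (commutator G).subtype) (by
    rw [relIndex, subgroupOf, comap_map_eq_self_of_injective (subtype_injective _), hidx])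

end CyclicQuotient

/-! ### Perfect groups have no cyclic subgroup of index twice an odd prime -/

section Perfect

open Subgroup

theorem eq_of_dvd_two_mul_prime {q d : ℕ} (hq : q.Prime) (h : d ∣ 2 * q) :
    d = 1 ∨ d = 2 ∨ d = q ∨ d = 2 * q := by
  obtain ⟨a, b, ha, hb, rfl⟩ := Nat.dvd_mul.1 h
  rcases (Nat.dvd_prime Nat.prime_two).1 ha with rfl | rfl <;>
    rcases (Nat.dvd_prime hq).1 hb with rfl | rfl <;> simp

theorem eq_three_of_mul_add_one_dvd {q n s : ℕ} (hq : 2 < q) (hs : s ≠ 0) (hn : n ∣ q - 1)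
    (h : q * s + 1 ∣ 2 * n) : q = 3 := by
  obtain ⟨r, hr⟩ := hn
  obtain ⟨a, ha⟩ := h
  have hr0 : r ≠ 0 := by
    rintro rfl
    omega
  have hn0 : n ≠ 0 := by
    rintro rfl
    omega
  have hle : n ≤ q - 1 := hr ▸ Nat.le_mul_of_pos_right n (Nat.pos_of_ne_zero hr0)
  have ha1 : a = 1 := by
    have : a ≠ 0 := by
      rintro rfl
      omega
    by_contra h
    nlinarith [Nat.mul_le_mul (Nat.le_mul_of_pos_right q (Nat.pos_of_ne_zero hs))
      (show 2 ≤ a by omega), Nat.sub_add_cancel (show 1 ≤ q by omega)]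
  have hs1 : s = 1 := by
    subst ha1
    by_contra h
    have := Nat.mul_le_mul_left q (show 2 ≤ s by omega)
    omega
  have hr1 : r = 1 := by
    subst ha1 hs1
    by_contra h
    have := Nat.mul_le_mul_left n (show 2 ≤ r by omega)
    omega
  subst ha1 hs1 hr1
  omega

variable {G : Type*} [Group G]

theorem inf_le_center_of_sup_eq_top {H K : Subgroup G} [IsMulCommutative H] [IsMulCommutative K]
    (h : H ⊔ K = ⊤) : H ⊓ K ≤ center G := by
  rw [← centralizer_univ, ← coe_top, ← h, le_centralizer_iff, sup_le_iff,
    le_centralizer_iff (H := H), le_centralizer_iff (H := K)]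
  exact ⟨inf_le_left.trans (le_centralizer H), inf_le_right.trans (le_centralizer K)⟩

theorem eq_or_eq_top_of_prime_index {H K : Subgroup G} (hH : H.index.Prime) (hle : H ≤ K) :
    K = H ∨ K = ⊤ := by
  have hmul := relIndex_mul_index hle
  rcases (Nat.dvd_prime hH).1 ⟨_, (mul_comm _ _).trans hmul |>.symm⟩ with h | h
  · exact Or.inr (index_eq_one.1 h)
  · exact Or.inl (le_antisymm (relIndex_eq_one.1 ((mul_eq_right₀ hH.ne_zero).1 (h ▸ hmul))) hle)

theorem le_normalizer_of_relIndex_eq_two {H J : Subgroup G} (hle : H ≤ J)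
    (h : H.relIndex J = 2) : J ≤ normalizer (H : Set G) :=
  (normal_subgroupOf_iff_le_normalizer hle).1 (normal_of_index_eq_two h)

theorem index_sylow_of_coprime [Finite G] {p m k : ℕ} [Fact p.Prime] (P : Sylow p G)
    (hcard : Nat.card G = m * p ^ k) (hm : p.Coprime m) : P.index = m := by
  refine Nat.dvd_antisymm ?_ ?_
  · have h := ((Nat.Prime.coprime_iff_not_dvd Fact.out).2 P.not_dvd_index).pow_left k
    have hdvd := P.index_dvd_card
    rw [hcard] at hdvd
    exact h.symm.dvd_of_dvd_mul_right hdvd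
  · obtain ⟨l, hl⟩ := IsPGroup.iff_card.1 P.isPGroup'
    refine (hm.symm.pow_right l).dvd_of_dvd_mul_left ?_
    rw [← hl, P.card_mul_index, hcard]
    exact dvd_mul_right _ _

section IsPerfect

variable [Finite G] [Group.IsPerfect G]

theorem eq_top_of_squarefree_index (K : Subgroup G) [K.Normal] (h : Squarefree K.index) :
    K = ⊤ := by
  have : IsZGroup (G ⧸ K) := IsZGroup.of_squarefree h
  by_contra hK
  have : Nontrivial (G ⧸ K) := QuotientGroup.nontrivial_iff.2 hK
  exact (IsZGroup.commutator_lt (G ⧸ K)).ne (Group.isPerfect_def.1 inferInstance)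

theorem index_ne_two_of_isPerfect (L : Subgroup G) : L.index ≠ 2 := by
  intro h
  have := normal_of_index_eq_two h
  rw [eq_top_of_squarefree_index L (h ▸ Nat.prime_two.squarefree), index_top] at h
  exact absurd h (by decide)

theorem index_ne_three_of_isPerfect (L : Subgroup G) : L.index ≠ 3 := by
  intro h
  have hdvd : L.normalCore.index ∣ 2 * 3 := by
    rw [normalCore_eq_ker, index_ker]
    refine (card_subgroup_dvd_card _).trans ?_
    rw [Nat.card_perm, ← index_eq_card, h]
    rfl
  have hsq : Squarefree (2 * 3) :=
    (Nat.squarefree_mul (by decide)).2 ⟨Nat.prime_two.squarefree, Nat.prime_three.squarefree⟩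
  have htop := eq_top_of_squarefree_index L.normalCore (hsq.squarefree_of_dvd hdvd)
  rw [top_le_iff.1 (htop.ge.trans L.normalCore_le), index_top] at h
  exact absurd h (by decide)

theorem normalizer_eq_self_of_prime_index {L : Subgroup G} (hL : L.index.Prime) :
    normalizer (L : Set G) = L := by
  refine (eq_or_eq_top_of_prime_index hL le_normalizer).resolve_right fun h => ?_
  have := normalizer_eq_top_iff.1 h
  rw [eq_top_of_squarefree_index L hL.squarefree, index_top] at hL
  exact Nat.not_prime_one hL

theorem even_card_of_index_eq_two_mul_odd {H : Subgroup G} {q : ℕ} (hq : Odd q)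
    (hidx : H.index = 2 * q) : Even (Nat.card H) := by
  rw [← Nat.not_odd_iff_even]
  intro hodd
  have hcard : 2 * (Nat.card H * q) = Nat.card G := by
    rw [← H.card_mul_index, hidx]
    ring
  have : Fact (Nat.Prime 2) := ⟨Nat.prime_two⟩
  obtain ⟨g, hg⟩ := exists_prime_orderOf_dvd_card' (G := G) 2 ⟨_, hcard.symm⟩
  have hg_index : (zpowers g).index = Nat.card H * q := by
    rw [← (zpowers g).card_mul_index, Nat.card_zpowers, hg] at hcard
    exact (Nat.eq_of_mul_eq_mul_left two_pos hcard).symm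
  obtain ⟨K, -, hK⟩ := exists_characteristic_index_eq_two (hg ▸ even_two)
    (hg_index ▸ hodd.mul hq)
  exact index_ne_two_of_isPerfect K hK

theorem inf_map_conj_eq_bot_of_isPerfect {q : ℕ} (hq : q.Prime) {H : Subgroup G}
    [IsMulCommutative H] (hcore : H.normalCore = ⊥) (hidx : H.index = 2 * q) {g : G}
    (hg : g ∉ normalizer (H : Set G)) : H ⊓ H.map (MulAut.conj g).toMonoidHom = ⊥ := by
  set K := H.map (MulAut.conj g).toMonoidHom
  have hK_index : K.index = 2 * q := (index_map_equiv H (MulAut.conj g)).trans hidx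
  have hH := hidx ▸ relIndex_mul_index (le_sup_left : H ≤ H ⊔ K)
  have hK := hK_index ▸ relIndex_mul_index (le_sup_right : K ≤ H ⊔ K)
  rcases eq_of_dvd_two_mul_prime hq (Dvd.intro_left _ hH) with h | h | h | h
  · have hcenter : H ⊓ K ≤ center G := inf_le_center_of_sup_eq_top (index_eq_one.1 h)
    have : (H ⊓ K).Normal := ⟨fun x hx g => by
      rwa [mem_center_iff.1 (hcenter hx) g, mul_inv_cancel_right]⟩
    exact le_bot_iff.1 (hcore ▸ normal_le_normalCore.2 inf_le_left)
  · exact absurd h (index_ne_two_of_isPerfect _)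
  · rw [h] at hH hK
    have hprime : (H ⊔ K).index.Prime := h ▸ hq
    have hH_normalizer := (eq_or_eq_top_of_prime_index hprime (le_normalizer_of_relIndex_eq_two
      le_sup_left (Nat.eq_of_mul_eq_mul_right hq.pos hH))).resolve_right fun h => hg (h ▸ mem_top g)
    have hmap : (normalizer (H : Set G)).map (MulAut.conj g).toMonoidHom = normalizer (K : Set G) :=
      map_equiv_normalizer_eq H (MulAut.conj g)
    have hK_normalizer := (eq_or_eq_top_of_prime_index hprime (le_normalizer_of_relIndex_eq_two
      le_sup_right (Nat.eq_of_mul_eq_mul_right hq.pos hK))).resolve_right fun htop => by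
        have hindex := index_map_equiv (normalizer (H : Set G)) (MulAut.conj g)
        rw [hH_normalizer, h] at hindex
        exact hq.one_lt.ne (index_top.symm.trans ((congrArg index (hmap.trans htop)).symm.trans
          (hH_normalizer ▸ hindex)))
    rw [hK_normalizer, ← hH_normalizer] at hmap
    have hgL := mem_normalizer_iff_map_conj_eq.2 hmap
    rw [normalizer_eq_self_of_prime_index (hH_normalizer ▸ hprime)] at hgL
    exact absurd hgL hg
  · rw [h] at hH
    have hKH : K ≤ H := le_sup_right.trans (relIndex_eq_one.1
      ((mul_eq_right₀ (Nat.mul_pos two_pos hq.pos).ne').1 hH))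
    exact absurd (mem_normalizer_iff_map_conj_eq.2 (eq_of_le_of_card_ge hKH
      (card_map_of_injective (MulEquiv.injective _)).ge)) hg

theorem exists_index_eq_relIndex_normalizer_add_of_isPerfect {c : G} (heven : Even (orderOf c))
    (htriv : ∀ g ∉ normalizer (zpowers c : Set G),
      zpowers c ⊓ (zpowers c).map (MulAut.conj g).toMonoidHom = ⊥) :
    ∃ r, (zpowers c).index =
      (zpowers c).relIndex (normalizer (zpowers c : Set G)) + 2 * r * orderOf c := by
  classical
  set H := zpowers c
  let _ := Fintype.ofFinite (G ⧸ H)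
  set σ := MulAction.toPermHom G (G ⧸ H) c
  have mem_fixedPoints (x : G ⧸ H) : x ∈ MulAction.fixedPoints H (G ⧸ H) ↔ σ x = x := by
    refine ⟨fun h => h ⟨c, mem_zpowers c⟩, fun h a => ?_⟩
    have hle : H ≤ MulAction.stabilizer G x := zpowers_le.2 h
    exact hle a.2
  obtain ⟨r, hr, hsign⟩ := exists_card_support_eq_mul_and_sign_eq σ heven
    (by rw [← map_pow, pow_orderOf_eq_one, map_one]) fun x hx j hj => by
      obtain ⟨g, rfl⟩ := QuotientGroup.mk_surjective x
      have hg : g ∉ normalizer (H : Set G) := fun hg =>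
        hx ((mem_fixedPoints _).1 (Sylow.mem_fixedPoints_mul_left_cosets_iff_mem_normalizer.2 hg))
      rw [← map_pow, eq_comm, MulAction.toPermHom_apply, MulAction.toPerm_apply,
        MulAction.Quotient.smul_mk, QuotientGroup.eq] at hj
      have hmem : c ^ j ∈ H ⊓ H.map (MulAut.conj g).toMonoidHom :=
        ⟨npow_mem_zpowers c j, _, hj, by simp [mul_assoc]⟩
      rw [htriv g hg] at hmem
      exact orderOf_dvd_of_pow_eq_one hmem
  have hσ : Equiv.Perm.sign σ = 1 := Abelianization.commutator_subset_ker
    (Equiv.Perm.sign.comp (MulAction.toPermHom G (G ⧸ H))) Group.IsPerfect.mem_commutator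
  obtain ⟨s, rfl⟩ : Even r := (neg_one_pow_eq_one_iff_even (by decide)).1 (hsign.symm.trans hσ)
  have hfixed : (Finset.univ.filter fun x => σ x = x).card =
      H.relIndex (normalizer (H : Set G)) := by
    rw [relIndex, index_eq_card, subgroupOf,
      ← Nat.card_congr (Sylow.fixedPointsMulLeftCosetsEquivQuotient H),
      Nat.card_congr (Equiv.subtypeEquivRight mem_fixedPoints), Nat.card_eq_fintype_card,
      Fintype.card_subtype]
  refine ⟨s, ?_⟩
  rw [two_mul, ← hr, ← hfixed, index_eq_card, Nat.card_eq_fintype_card, ← Finset.card_univ,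
    ← Finset.card_filter_add_card_filter_not fun x => σ x = x]
  rfl

theorem index_normalizer_eq_of_isPerfect {c : G} {q : ℕ} (hq : q.Prime) (hq2 : q ≠ 2)
    (hcore : (zpowers c).normalCore = ⊥) (hidx : (zpowers c).index = 2 * q) :
    (normalizer (zpowers c : Set G)).index = q ∧ orderOf c ∣ q - 1 := by
  set H := zpowers c
  have hqodd : Odd q := hq.odd_of_ne_two hq2
  have heven : Even (orderOf c) :=
    Nat.card_zpowers c ▸ even_card_of_index_eq_two_mul_odd hqodd hidx
  obtain ⟨r, hr⟩ := exists_index_eq_relIndex_normalizer_add_of_isPerfect heven fun g hg =>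
    inf_map_conj_eq_bot_of_isPerfect hq hcore hidx hg
  have hmul := relIndex_mul_index (le_normalizer (H := H))
  change H.index = _ at hr
  rw [hidx] at hr hmul
  rcases eq_of_dvd_two_mul_prime hq (Dvd.intro_left _ hmul) with h | h | h | h
  · have := normalizer_eq_top_iff.1 (index_eq_one.1 h)
    rw [normalCore_eq_self, zpowers_eq_bot] at hcore
    rw [hcore, orderOf_one] at heven
    exact absurd heven Nat.not_even_one
  · exact absurd h (index_ne_two_of_isPerfect _)
  · rw [h] at hmul
    rw [Nat.eq_of_mul_eq_mul_right hq.pos hmul] at hr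
    refine ⟨h, r, ?_⟩
    have : 2 * r * orderOf c = 2 * (orderOf c * r) := by ring
    omega
  · rw [h] at hmul
    rw [(mul_eq_right₀ (Nat.mul_pos two_pos hq.pos).ne').1 hmul, mul_assoc] at hr
    omega

theorem card_sylow_ne_one_of_isPerfect {c : G} {q : ℕ} [Fact q.Prime]
    (hcard : Nat.card G = 2 * orderOf c * q) (hcoprime : q.Coprime (2 * orderOf c)) :
    Nat.card (Sylow q G) ≠ 1 := by
  intro hone
  obtain ⟨P⟩ : Nonempty (Sylow q G) := inferInstance
  have : Subsingleton (Sylow q G) := (Nat.card_eq_one_iff_unique.1 hone).1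
  have hP : P.Normal := P.normal_of_subsingleton
  have hinf : (P : Subgroup G) ⊓ zpowers c = ⊥ := by
    refine disjoint_iff.1 (disjoint_of_coprime_natCard ?_)
    obtain ⟨k, hk⟩ := IsPGroup.iff_card.1 P.isPGroup'
    rw [hk, Nat.card_zpowers]
    exact hcoprime.coprime_mul_left_right.pow_left k
  have hindex := relIndex_mul_index
    (le_sup_left : (P : Subgroup G) ≤ (P : Subgroup G) ⊔ zpowers c)
  rw [relIndex_sup_left, ← inf_relIndex_right, hinf, relIndex_bot_left, Nat.card_zpowers,
    index_sylow_of_coprime P (k := 1) (by rwa [pow_one]) hcoprime, mul_comm 2] at hindex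
  exact index_ne_two_of_isPerfect _ (Nat.eq_of_mul_eq_mul_left (orderOf_pos c) hindex)

theorem normalCore_ne_bot_of_isPerfect {c : G} {q : ℕ} (hq : q.Prime) (hq2 : q ≠ 2)
    (hidx : (zpowers c).index = 2 * q) : (zpowers c).normalCore ≠ ⊥ := by
  intro hcore
  obtain ⟨hnormalizer, hdvd⟩ := index_normalizer_eq_of_isPerfect hq hq2 hcore hidx
  have hle := Nat.le_of_dvd (Nat.sub_pos_of_lt hq.one_lt) hdvd
  have hcard : Nat.card G = 2 * orderOf c * q := by
    rw [← (zpowers c).card_mul_index, hidx, Nat.card_zpowers]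
    ring
  have hcoprime : q.Coprime (2 * orderOf c) := Nat.Coprime.mul_right
    ((Nat.coprime_primes hq Nat.prime_two).2 hq2)
    (Nat.coprime_of_lt_prime (orderOf_pos c).ne' (by have := hq.pos; omega) hq)
  have : Fact q.Prime := ⟨hq⟩
  obtain ⟨P⟩ : Nonempty (Sylow q G) := inferInstance
  obtain ⟨s, hs⟩ := (Nat.modEq_iff_dvd' Nat.card_pos).1 (card_sylow_modEq_one q G).symm
  have hcard_sylow : Nat.card (Sylow q G) = q * s + 1 := by
    have := Nat.card_pos (α := Sylow q G)
    omega
  have hs0 : s ≠ 0 := by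
    rintro rfl
    exact card_sylow_ne_one_of_isPerfect hcard hcoprime hcard_sylow
  refine index_ne_three_of_isPerfect _ (hnormalizer.trans ?_)
  refine eq_three_of_mul_add_one_dvd (hq.two_le.lt_of_ne' hq2) hs0 hdvd (hcard_sylow ▸ ?_)
  exact index_sylow_of_coprime P (k := 1) (by rwa [pow_one]) hcoprime ▸ P.card_dvd_index

end IsPerfect

theorem not_isPerfect_of_index_zpowers [Finite G] {c : G} {q : ℕ} (hq : q.Prime) (hq2 : q ≠ 2)
    (hidx : (zpowers c).index = 2 * q) : ¬ Group.IsPerfect G := by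
  intro _
  set K := (zpowers c).normalCore
  let f := QuotientGroup.mk' K
  have hle : f.ker ≤ zpowers c := (QuotientGroup.ker_mk' K).le.trans (normalCore_le _)
  refine normalCore_ne_bot_of_isPerfect (c := f c) hq hq2 ?_ ?_
  · rw [← MonoidHom.map_zpowers, index_map_eq _ (QuotientGroup.mk'_surjective K) hle, hidx]
  · have hcomap : (zpowers (f c)).normalCore.comap f ≤ K := by
      refine normal_le_normalCore.2 ((comap_mono (normalCore_le _)).trans ?_)
      rw [← MonoidHom.map_zpowers, comap_map_eq, sup_le_iff]
      exact ⟨le_rfl, hle⟩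
    rw [← map_comap_eq_self_of_surjective (QuotientGroup.mk'_surjective K)
        (zpowers (f c)).normalCore, eq_bot_iff, ← QuotientGroup.map_mk'_self K]
    exact map_mono hcomap

end Perfect

/-! ### Commutator subgroups of prime index with a cyclic subgroup of index two -/

section CyclicIndexTwo

open Subgroup

theorem mem_of_zpow_mem_of_isCoprime {G : Type*} [Group G] {K : Subgroup G} {x : G} {i j : ℤ}
    (hij : IsCoprime i j) (hi : x ^ i ∈ K) (hj : x ^ j ∈ K) : x ∈ K := by
  obtain ⟨u, v, huv⟩ := hij
  rw [← zpow_one x, ← huv, zpow_add, mul_comm u, mul_comm v, zpow_mul, zpow_mul]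
  exact mul_mem (zpow_mem hi u) (zpow_mem hj v)

theorem mem_of_pow_mem_of_coprime {G : Type*} [Group G] {K : Subgroup G} {x : G} {i j : ℕ}
    (hij : i.Coprime j) (hi : x ^ i ∈ K) (hj : x ^ j ∈ K) : x ∈ K :=
  mem_of_zpow_mem_of_isCoprime (Nat.isCoprime_iff_coprime.2 hij) (by rwa [zpow_natCast])
    (by rwa [zpow_natCast])

theorem mem_normalizer_closure {G : Type*} [Group G] [Finite G] {S : Set G} {x : G}
    (h : ∀ s ∈ S, x * s * x⁻¹ ∈ closure S) : x ∈ normalizer (closure S : Set G) := by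
  have hle : closure S ≤ (closure S).comap (MulAut.conj x).toMonoidHom := (closure_le _).2 h
  exact mem_normalizer_fintype fun _ hg => hle hg

/-- `τ` permutes the involutions `u`, `v` and `u * v` of a four-group by conjugation. -/
theorem eq_three_of_conj_pow_prime {Q : Type*} [Group Q] {τ u v : Q} {q : ℕ} (hq : q.Prime)
    (hq2 : q ≠ 2) (hu : τ * u * τ⁻¹ = v) (hv : τ * v * τ⁻¹ = u ∨ τ * v * τ⁻¹ = u * v)
    (hvu : v ≠ u) (huv : Commute u v) (hvv : v * v = 1) (hτq : Commute (τ ^ q) u) :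
    q = 3 ∧ τ * v * τ⁻¹ = u * v := by
  have not_commute_pow {j : ℕ} (hj : q.Coprime j) : ¬ Commute (τ ^ j) u := fun hτj => by
    have hτ : τ ∈ centralizer {u} := mem_of_pow_mem_of_coprime hj
      (mem_centralizer_singleton_iff.2 hτq) (mem_centralizer_singleton_iff.2 hτj)
    rw [mul_inv_eq_iff_eq_mul.2 (mem_centralizer_singleton_iff.1 hτ)] at hu
    exact hvu hu.symm
  have conj_pow_succ (j : ℕ) (x : Q) :
      τ ^ (j + 1) * x * (τ ^ (j + 1))⁻¹ = τ ^ j * (τ * x * τ⁻¹) * (τ ^ j)⁻¹ := by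
    simp only [pow_succ, mul_inv_rev, mul_assoc]
  have hv' : τ * v * τ⁻¹ = u * v := hv.resolve_left fun hv => by
    refine not_commute_pow ((Nat.coprime_primes hq Nat.prime_two).2 hq2) ?_
    refine mul_inv_eq_iff_eq_mul.1 ?_
    rw [conj_pow_succ, hu, pow_one, hv]
  refine ⟨by_contra fun hq3 => ?_, hv'⟩
  refine not_commute_pow ((Nat.coprime_primes hq Nat.prime_three).2 hq3) ?_
  refine mul_inv_eq_iff_eq_mul.1 ?_
  rw [conj_pow_succ, hu, conj_pow_succ, hv', pow_one, ← conj_mul, hu, hv', huv.eq, ← mul_assoc,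
    hvv, one_mul]

variable {G : Type*} [Group G]

theorem commute_of_mem_commutator_of_isCyclic (N : Subgroup G) [N.Normal] [IsCyclic N] {d n : G}
    (hd : d ∈ commutator G) (hn : n ∈ N) : Commute d n := by
  let f : G →* (ZMod (Nat.card N))ˣ :=
    (IsCyclic.mulAutMulEquiv N).toMonoidHom.comp MulAut.conjNormal
  have hf : IsCyclic.mulAutMulEquiv N (MulAut.conjNormal d) = 1 :=
    Abelianization.commutator_subset_ker f hd
  have hconj : (MulAut.conjNormal d : MulAut N) = 1 := by
    rwa [map_eq_one_iff _ (MulEquiv.injective _)] at hf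
  refine mul_inv_eq_iff_eq_mul.1 ?_
  rw [← MulAut.conjNormal_apply d ⟨n, hn⟩, hconj]
  rfl

/-- The commutator subgroup has odd prime index, `t` lies outside of it, and the cyclic group
generated by `c` is a subgroup of index two of it. -/
structure IsCyclicIndexTwo (c t : G) : Prop where
  prime_index : (commutator G).index.Prime
  index_ne_two : (commutator G).index ≠ 2
  mem_commutator : c ∈ commutator G
  relIndex_eq_two : (zpowers c).relIndex (commutator G) = 2
  notMem_commutator : t ∉ commutator G

namespace IsCyclicIndexTwo

variable {c t : G}

theorem isCyclic_quotient (h : IsCyclicIndexTwo c t) : IsCyclic (G ⧸ commutator G) :=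
  have : Fact (commutator G).index.Prime := ⟨h.prime_index⟩
  isCyclic_of_prime_card (index_eq_card _).symm

theorem eq_top (h : IsCyclicIndexTwo c t) {M : Subgroup G} (hM : commutator G ≤ M) (ht : t ∈ M) :
    M = ⊤ :=
  (eq_or_eq_top_of_prime_index h.prime_index hM).resolve_left fun hM =>
    h.notMem_commutator (hM ▸ ht)

theorem zpowers_le_commutator (h : IsCyclicIndexTwo c t) : zpowers c ≤ commutator G :=
  zpowers_le.2 h.mem_commutator

theorem conj_mem_commutator (h : IsCyclicIndexTwo c t) : t * c * t⁻¹ ∈ commutator G :=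
  (inferInstance : (commutator G).Normal).conj_mem c h.mem_commutator t

theorem conj_mem_zpowers (h : IsCyclicIndexTwo c t) {d x : G} (hd : d ∈ commutator G)
    (hx : x ∈ zpowers c) : d * x * d⁻¹ ∈ zpowers c :=
  (mem_normalizer_iff.1 (le_normalizer_of_relIndex_eq_two h.zpowers_le_commutator
    h.relIndex_eq_two hd) x).1 hx

theorem mul_mem_zpowers (h : IsCyclicIndexTwo c t) {a b : G} (ha : a ∈ commutator G)
    (hb : b ∈ commutator G) (hac : a ∉ zpowers c) (hbc : b ∉ zpowers c) : a * b ∈ zpowers c :=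
  (mul_mem_iff_of_index_two (H := (zpowers c).subgroupOf (commutator G)) h.relIndex_eq_two
    (a := ⟨a, ha⟩) (b := ⟨b, hb⟩)).2 (iff_of_false hac hbc)

theorem sq_mem_zpowers_sq {x : G} (hx : x ∈ zpowers c) : x ^ 2 ∈ zpowers (c ^ 2) := by
  obtain ⟨i, rfl⟩ := hx
  exact ⟨i, by exact_mod_cast zpow_comm c 2 i⟩

theorem mem_or_inv_mul_mem_zpowers_sq {x : G} (hx : x ∈ zpowers c) :
    x ∈ zpowers (c ^ 2) ∨ c⁻¹ * x ∈ zpowers (c ^ 2) := by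
  obtain ⟨i, rfl⟩ := mem_zpowers_iff.1 hx
  rcases Int.even_or_odd' i with ⟨j, rfl | rfl⟩
  · left
    rw [zpow_mul, zpow_ofNat]
    exact zpow_mem (mem_zpowers _) j
  · right
    rw [add_comm, zpow_add, zpow_one, inv_mul_cancel_left, zpow_mul, zpow_ofNat]
    exact zpow_mem (mem_zpowers _) j

variable [Finite G]

theorem zpowers_normal (h : IsCyclicIndexTwo c t) {x : G}
    (hD : ∀ d ∈ commutator G, d * x * d⁻¹ ∈ zpowers x) (ht : t * x * t⁻¹ ∈ zpowers x) :
    (zpowers x).Normal := by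
  have mem_normalizer {g : G} (hg : g * x * g⁻¹ ∈ zpowers x) :
      g ∈ normalizer (zpowers x : Set G) := by
    rw [zpowers_eq_closure] at hg ⊢
    exact mem_normalizer_closure fun s hs => by rwa [Set.mem_singleton_iff.1 hs]
  rw [← normalizer_eq_top_iff]
  exact h.eq_top (fun d hd => mem_normalizer (hD d hd)) (mem_normalizer ht)

theorem conj_notMem_zpowers (h : IsCyclicIndexTwo c t) : t * c * t⁻¹ ∉ zpowers c := by
  intro hmem
  have := h.zpowers_normal (fun d hd => h.conj_mem_zpowers hd (mem_zpowers c)) hmem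
  have := h.isCyclic_quotient
  exact relIndex_commutator_ne_two (zpowers c) h.relIndex_eq_two

theorem conj_sq_mem_zpowers (h : IsCyclicIndexTwo c t) : (t * c * t⁻¹) ^ 2 ∈ zpowers c := by
  rw [sq]
  exact h.mul_mem_zpowers h.conj_mem_commutator h.conj_mem_commutator h.conj_notMem_zpowers
    h.conj_notMem_zpowers

theorem even_orderOf (h : IsCyclicIndexTwo c t) : Even (orderOf c) := by
  rw [← Nat.not_odd_iff_even]
  intro hodd
  have hord : orderOf (t * c * t⁻¹) = orderOf c := (MulAut.conj t).orderOf_eq c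
  refine h.conj_notMem_zpowers (mem_of_pow_mem_of_coprime (Nat.coprime_two_left.2 hodd)
    h.conj_sq_mem_zpowers ?_)
  rw [← hord, pow_orderOf_eq_one]
  exact one_mem _

theorem conj_sq_mem_zpowers_sq (h : IsCyclicIndexTwo c t) :
    (t * c * t⁻¹) ^ 2 ∈ zpowers (c ^ 2) := by
  obtain ⟨i, hi⟩ := mem_zpowers_iff.1 h.conj_sq_mem_zpowers
  obtain ⟨n, hn⟩ := h.even_orderOf.two_dvd
  have hn0 : (n : ℤ) ≠ 0 := by
    have := orderOf_pos c
    omega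
  have hpow : c ^ (i * n) = 1 := by
    rw [zpow_mul, zpow_natCast, hi, ← pow_mul, ← hn, conj_pow, pow_orderOf_eq_one, mul_one,
      mul_inv_cancel]
  rw [← orderOf_dvd_iff_zpow_eq_one, hn, Nat.cast_mul] at hpow
  obtain ⟨j, rfl⟩ := Int.dvd_of_mul_dvd_mul_right hn0 hpow
  rw [← hi, Nat.cast_ofNat, zpow_mul, zpow_ofNat]
  exact zpow_mem (mem_zpowers _) j

theorem notMem_zpowers_sq (h : IsCyclicIndexTwo c t) : c ∉ zpowers (c ^ 2) := by
  rintro ⟨i, hi⟩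
  have hpow : c ^ (2 * i - 1) = 1 := by
    rw [zpow_sub_one, zpow_mul, zpow_ofNat, mul_inv_eq_one]
    exact hi
  have heven : (2 : ℤ) ∣ orderOf c := by exact_mod_cast h.even_orderOf.two_dvd
  have := heven.trans (orderOf_dvd_iff_zpow_eq_one.2 hpow)
  omega

theorem zpowers_sq_normal (h : IsCyclicIndexTwo c t) : (zpowers (c ^ 2)).Normal := by
  refine h.zpowers_normal (fun d hd => ?_) ?_
  · rw [← conj_pow]
    exact sq_mem_zpowers_sq (h.conj_mem_zpowers hd (mem_zpowers c))
  · rw [← conj_pow]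
    exact h.conj_sq_mem_zpowers_sq

theorem conj_mul_inv_mem_zpowers_sq (h : IsCyclicIndexTwo c t) {d : G}
    (hd : d ∈ commutator G) : d * c * d⁻¹ * c⁻¹ ∈ zpowers (c ^ 2) := by
  have hnormal := h.zpowers_sq_normal
  rw [hnormal.mem_comm_iff]
  refine (mem_or_inv_mul_mem_zpowers_sq (h.conj_mem_zpowers hd (mem_zpowers c))).resolve_left ?_
  intro hmem
  refine h.notMem_zpowers_sq ?_
  simpa [mul_assoc] using hnormal.conj_mem _ hmem d⁻¹

theorem commutator_le (h : IsCyclicIndexTwo c t) {M : Subgroup G} (hc : c ∈ M)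
    (hconj : t * c * t⁻¹ ∈ M) : commutator G ≤ M := by
  intro d hd
  by_cases hdc : d ∈ zpowers c
  · exact zpowers_le.2 hc hdc
  · have hmul := h.mul_mem_zpowers hd (inv_mem h.conj_mem_commutator) hdc
      (inv_mem_iff.not.2 h.conj_notMem_zpowers)
    exact inv_mul_cancel_right d _ ▸ mul_mem (zpowers_le.2 hc hmul) hconj

theorem inv_mul_conj_mem_zpowers_sq_or (h : IsCyclicIndexTwo c t) :
    c⁻¹ * (t * (t * c * t⁻¹) * t⁻¹) ∈ zpowers (c ^ 2) ∨
      c⁻¹ * (t * (t * c * t⁻¹) * t⁻¹ * (t * c * t⁻¹)⁻¹) ∈ zpowers (c ^ 2) := by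
  have hnormal := h.zpowers_sq_normal
  have hle : zpowers (c ^ 2) ≤ zpowers c := zpowers_le.2 (npow_mem_zpowers c 2)
  have of_conj_mem {x : G} (hx : t * x * t⁻¹ ∈ zpowers (c ^ 2)) : x ∈ zpowers c :=
    hle (by simpa [mul_assoc] using hnormal.conj_mem _ hx t⁻¹)
  have hd : t * (t * c * t⁻¹) * t⁻¹ ∈ commutator G :=
    (inferInstance : (commutator G).Normal).conj_mem _ h.conj_mem_commutator t
  by_cases hmem : t * (t * c * t⁻¹) * t⁻¹ ∈ zpowers c
  · exact Or.inl ((mem_or_inv_mul_mem_zpowers_sq hmem).resolve_left fun hmem =>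
      h.conj_notMem_zpowers (of_conj_mem hmem))
  · have hmul := h.mul_mem_zpowers hd (inv_mem h.conj_mem_commutator) hmem
      (inv_mem_iff.not.2 h.conj_notMem_zpowers)
    refine Or.inr ((mem_or_inv_mul_mem_zpowers_sq hmul).resolve_left fun hmem => ?_)
    rw [conj_inv, conj_mul] at hmem
    exact h.conj_notMem_zpowers
      (inv_mul_cancel_right (t * c * t⁻¹) c ▸ mul_mem (of_conj_mem hmem) (mem_zpowers c))

theorem index_eq_three_and_conj (h : IsCyclicIndexTwo c t) :
    (commutator G).index = 3 ∧
      (c * (t * c * t⁻¹))⁻¹ * (t * (t * c * t⁻¹) * t⁻¹) ∈ zpowers (c ^ 2) := by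
  have hnormal := h.zpowers_sq_normal
  let π := QuotientGroup.mk' (zpowers (c ^ 2))
  have π_eq_one {x : G} : π x = 1 ↔ x ∈ zpowers (c ^ 2) := QuotientGroup.eq_one_iff x
  have π_eq {x y : G} : π x = π y ↔ x⁻¹ * y ∈ zpowers (c ^ 2) := QuotientGroup.eq
  have commute_π {d : G} (hd : d ∈ commutator G) : Commute (π d) (π c) := by
    rw [← commutatorElement_eq_one_iff_commute, commutatorElement_def]
    simpa using π_eq_one.2 (h.conj_mul_inv_mem_zpowers_sq hd)
  have hne : π (t * c * t⁻¹) ≠ π c := fun heq => h.conj_notMem_zpowers (by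
    simpa using mul_mem (mem_zpowers c)
      (zpowers_le.2 (npow_mem_zpowers c 2) (π_eq.1 heq.symm)))
  have hcases : π t * π (t * c * t⁻¹) * (π t)⁻¹ = π c ∨
      π t * π (t * c * t⁻¹) * (π t)⁻¹ = π c * π (t * c * t⁻¹) := by
    refine h.inv_mul_conj_mem_zpowers_sq_or.imp (fun hmem => ?_) fun hmem => ?_
    · simpa using (π_eq.2 hmem).symm
    · refine (eq_mul_inv_iff_mul_eq.1 ?_).symm
      simpa using π_eq.2 hmem
  have hthree := eq_three_of_conj_pow_prime (τ := π t) h.prime_index h.index_ne_two (by simp)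
    hcases hne (commute_π h.conj_mem_commutator).symm
    (by rw [← map_mul, ← sq, π_eq_one]; exact h.conj_sq_mem_zpowers_sq)
    (by rw [← map_pow]; exact commute_π (pow_index_mem _ t))
  refine ⟨hthree.1, ?_⟩
  rw [← π_eq]
  simpa using hthree.2.symm

end IsCyclicIndexTwo

theorem conj_pow_three_of_conj_eq_zpow {G : Type*} [Group G] {t x : G} {r : ℤ}
    (h : t * x * t⁻¹ = x ^ r) : t ^ 3 * x * (t ^ 3)⁻¹ = x ^ (r ^ 3) := by
  have conj_zpow_eq (s : ℤ) : t * x ^ s * t⁻¹ = x ^ (r * s) := by rw [← conj_zpow, h, zpow_mul]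
  calc t ^ 3 * x * (t ^ 3)⁻¹ = t * (t * (t * x * t⁻¹) * t⁻¹) * t⁻¹ := by
        simp only [pow_succ, pow_zero, one_mul, mul_inv_rev, mul_assoc]
    _ = x ^ (r ^ 3) := by
        rw [h, conj_zpow_eq, conj_zpow_eq]
        ring_nf

section CommonSquare

variable {G : Type*} [Group G] {b b₁ e z : G}

theorem sq_eq_one_of_sq_eq_sq (heb₁ : Commute e b₁) (h : b₁ * b = e * (b * b₁))
    (hsq : b₁ ^ 2 = b ^ 2) : e ^ 2 = 1 := by
  have hcomm : b₁ ^ 2 * b = e ^ 2 * (b * b₁ ^ 2) :=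
    calc b₁ ^ 2 * b = b₁ * (b₁ * b) := by rw [sq, mul_assoc]
      _ = b₁ * e * (b * b₁) := by rw [h, mul_assoc]
      _ = e * (b₁ * b) * b₁ := by rw [← heb₁.eq]; simp only [mul_assoc]
      _ = e ^ 2 * (b * b₁ ^ 2) := by rw [h, sq, sq]; simp only [mul_assoc]
  rw [hsq, ← pow_succ, ← pow_succ'] at hcomm
  exact mul_eq_right.1 hcomm.symm

theorem mul_sq_mul_sq_eq_one (heb : Commute e b) (hzb : Commute z b) (hzb₁ : Commute z b₁)
    (h : b₁ * b = e * (b * b₁)) (hsq : b₁ ^ 2 = b ^ 2) (hsq' : (b * b₁ * z) ^ 2 = b ^ 2) :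
    e * b ^ 2 * z ^ 2 = 1 := by
  rw [(hzb.mul_right hzb₁).symm.mul_pow] at hsq'
  have hmul : (b * b₁) ^ 2 = b ^ 2 * e * b ^ 2 :=
    calc (b * b₁) ^ 2 = b * (b₁ * b) * b₁ := by simp only [sq, mul_assoc]
      _ = b * e * b * b₁ ^ 2 := by rw [h, sq]; simp only [mul_assoc]
      _ = e * b ^ 2 * b ^ 2 := by rw [← heb.eq, hsq, mul_assoc e b b, sq]
      _ = b ^ 2 * e * b ^ 2 := by rw [(heb.pow_right 2).eq]
  rw [hmul, mul_assoc, mul_assoc] at hsq'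
  rw [mul_assoc]
  exact mul_eq_left.1 hsq'

theorem quaternion_relations_of_commute {a m : ℕ} (hm : Odd m) (hba : b ^ 2 ^ a = 1)
    (hzm : z ^ m ∈ zpowers (b ^ 2)) (heb : Commute e b) (heb₁ : Commute e b₁)
    (hzb : Commute z b) (hzb₁ : Commute z b₁) (h : b₁ * b = e * (b * b₁))
    (hsq : b₁ ^ 2 = b ^ 2) (hsq' : (b * b₁ * z) ^ 2 = b ^ 2) :
    b ^ 4 = 1 ∧ e = b ^ 2 ∧ z ∈ zpowers b := by
  have he2 : e ^ 2 = 1 := sq_eq_one_of_sq_eq_sq heb₁ h hsq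
  have hebz : e * (b ^ 2 * z ^ 2) = 1 := by
    rw [← mul_assoc]
    exact mul_sq_mul_sq_eq_one heb hzb hzb₁ h hsq hsq'
  have hbz : b ^ 4 * z ^ 4 = 1 :=
    calc b ^ 4 * z ^ 4 = (b ^ 2 * z ^ 2) ^ 2 := by
          rw [(hzb.pow_pow 2 2).symm.mul_pow, ← pow_mul, ← pow_mul]
      _ = 1 := by rw [← inv_eq_of_mul_eq_one_right hebz, inv_pow, he2, inv_one]
  obtain ⟨i, hi⟩ := mem_zpowers_iff.1 hzm
  have hb4 : b ^ 4 ∈ (⊥ : Subgroup G) := by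
    have hodd : Odd (m + 2 * i) := (Odd.natCast hm).add_even (even_two_mul i)
    refine mem_of_zpow_mem_of_isCoprime ((Int.isCoprime_two_left.2 hodd).pow_left (m := a)) ?_ ?_
    · have hpow : (b ^ 4) ^ 2 ^ a = 1 := by rw [← pow_mul, mul_comm, pow_mul, hba, one_pow]
      exact_mod_cast hpow
    · have hpow : (b ^ 4) ^ (2 * i) = (z ^ 4) ^ m := by
        rw [← pow_mul, mul_comm 4, pow_mul, ← hi]
        simp only [← zpow_natCast, ← zpow_mul]
        congr 1
        push_cast
        ring
      rw [mem_bot, zpow_add, zpow_natCast, hpow, ← (hzb.pow_pow 4 4).symm.mul_pow, hbz, one_pow]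
  rw [mem_bot] at hb4
  have hz2 : z ^ 2 ∈ (⊥ : Subgroup G) := by
    refine mem_of_pow_mem_of_coprime (Nat.coprime_two_left.2 hm) ?_ ?_
    · rw [hb4, one_mul] at hbz
      rwa [← pow_mul]
    · rw [mem_bot, ← pow_mul, mul_comm, pow_mul, ← hi, ← zpow_natCast, ← zpow_mul, mul_comm,
        zpow_mul, zpow_natCast, ← pow_mul, hb4, one_zpow]
  rw [mem_bot] at hz2
  refine ⟨hb4, ?_, ?_⟩
  · rw [hz2, mul_one] at hebz
    rw [eq_inv_of_mul_eq_one_left hebz]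
    exact inv_eq_of_mul_eq_one_left (by rw [← pow_add, hb4])
  · obtain ⟨j, rfl⟩ := hm
    rw [pow_succ z, pow_mul, hz2, one_pow, one_mul] at hzm
    exact zpowers_le.2 (npow_mem_zpowers b 2) hzm

end CommonSquare

namespace IsCyclicIndexTwo

variable {G : Type*} [Group G] {c t x : G} {r : ℤ} {a m : ℕ}

theorem conj_eq_zpow (hr : t * c ^ 2 * t⁻¹ = (c ^ 2) ^ r) (hx : x ∈ zpowers (c ^ 2)) :
    t * x * t⁻¹ = x ^ r := by
  obtain ⟨i, rfl⟩ := mem_zpowers_iff.1 hx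
  rw [← conj_zpow, hr, ← zpow_mul, ← zpow_mul, mul_comm]

theorem pow_mem_zpowers_sq {i : ℕ} (hi : Even i) : c ^ i ∈ zpowers (c ^ 2) := by
  obtain ⟨j, rfl⟩ := hi.two_dvd
  rw [pow_mul]
  exact npow_mem_zpowers _ j

theorem inv_mul_pow_mem_zpowers_sq (hm : Odd m) : c⁻¹ * c ^ m ∈ zpowers (c ^ 2) := by
  obtain ⟨i, rfl⟩ := hm
  rw [pow_succ' c (2 * i), inv_mul_cancel_left]
  exact pow_mem_zpowers_sq (even_two_mul i)

theorem orderOf_pow_left (hm : Odd m) (hn : orderOf c = 2 ^ a * m) : orderOf (c ^ m) = 2 ^ a := by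
  rw [orderOf_pow_of_dvd hm.pos.ne' (hn ▸ dvd_mul_left _ _), hn, Nat.mul_div_cancel _ hm.pos]

theorem orderOf_pow_right (hn : orderOf c = 2 ^ a * m) : orderOf (c ^ 2 ^ a) = m := by
  rw [orderOf_pow_of_dvd (by positivity) (hn ▸ dvd_mul_right _ _), hn,
    Nat.mul_div_cancel_left _ (by positivity)]

variable [Finite G]

theorem exists_conj_sq_eq_zpow (h : IsCyclicIndexTwo c t) :
    ∃ r : ℤ, t * c ^ 2 * t⁻¹ = (c ^ 2) ^ r := by
  obtain ⟨r, hr⟩ := mem_zpowers_iff.1 (h.zpowers_sq_normal.conj_mem _ (mem_zpowers _) t)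
  exact ⟨r, hr.symm⟩

theorem commute_of_mem (h : IsCyclicIndexTwo c t) {d : G} (hd : d ∈ commutator G)
    (hx : x ∈ zpowers (c ^ 2)) : Commute d x :=
  have := h.zpowers_sq_normal
  commute_of_mem_commutator_of_isCyclic (zpowers (c ^ 2)) hd hx

theorem zpow_pow_three_sub_one_eq_one (h : IsCyclicIndexTwo c t)
    (hr : t * c ^ 2 * t⁻¹ = (c ^ 2) ^ r) (hx : x ∈ zpowers (c ^ 2)) : x ^ (r ^ 3 - 1) = 1 := by
  have ht : t ^ 3 ∈ commutator G := h.index_eq_three_and_conj.1 ▸ pow_index_mem _ t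
  rw [zpow_sub_one, ← conj_pow_three_of_conj_eq_zpow (conj_eq_zpow hr hx),
    (h.commute_of_mem ht hx).eq, mul_inv_cancel_right, mul_inv_cancel]

theorem mem_center_of_pow_eq_one (h : IsCyclicIndexTwo c t)
    (hr : t * c ^ 2 * t⁻¹ = (c ^ 2) ^ r) (hx : x ∈ zpowers (c ^ 2)) (hxa : x ^ 2 ^ a = 1) :
    x ∈ center G := by
  have hodd : Odd (r ^ 2 + r + 1) := by
    have heven : Even (r ^ 2 + r) := by
      rw [sq, ← mul_add_one]
      exact Int.even_mul_succ_self r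
    exact heven.add_one
  have htriv : x ^ (r - 1) ∈ (⊥ : Subgroup G) := by
    refine mem_of_zpow_mem_of_isCoprime ((Int.isCoprime_two_left.2 hodd).pow_left (m := a)) ?_ ?_
    · rw [mem_bot, ← zpow_mul, mul_comm, zpow_mul]
      rw [show x ^ ((2 : ℤ) ^ a) = 1 by exact_mod_cast hxa, one_zpow]
    · rw [mem_bot, ← zpow_mul]
      convert h.zpow_pow_three_sub_one_eq_one hr hx using 2
      ring
  have hcentralizer : centralizer {x} = ⊤ := by
    refine h.eq_top (fun d hd => mem_centralizer_singleton_iff.2 (h.commute_of_mem hd hx)) ?_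
    rw [mem_centralizer_singleton_iff, ← mul_inv_eq_iff_eq_mul, conj_eq_zpow hr hx,
      ← mul_inv_eq_one, ← zpow_sub_one]
    exact htriv
  exact mem_center_iff.2 fun g => mem_centralizer_singleton_iff.1 (hcentralizer ▸ mem_top g)

theorem ne_zero_of_orderOf_eq (h : IsCyclicIndexTwo c t) (hm : Odd m)
    (hn : orderOf c = 2 ^ a * m) : a ≠ 0 := by
  rintro rfl
  have heven := h.even_orderOf
  rw [hn, pow_zero, one_mul] at heven
  exact Nat.not_even_iff_odd.2 hm heven

theorem conj_pow_sq_eq (h : IsCyclicIndexTwo c t) (hm : Odd m) (hn : orderOf c = 2 ^ a * m) :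
    (t * c ^ m * t⁻¹) ^ 2 = (c ^ m) ^ 2 := by
  obtain ⟨r, hr⟩ := h.exists_conj_sq_eq_zpow
  have hcenter : (c ^ m) ^ 2 ∈ center G := by
    refine h.mem_center_of_pow_eq_one (a := a) hr ?_ ?_
    · rw [← pow_mul]
      exact pow_mem_zpowers_sq (even_two.mul_left m)
    · rw [← pow_mul, mul_comm, pow_mul, ← orderOf_pow_left hm hn, pow_orderOf_eq_one, one_pow]
  rw [conj_pow, mem_center_iff.1 hcenter t, mul_inv_cancel_right]

theorem conj_pow_commutator_mem (h : IsCyclicIndexTwo c t) (hm : Odd m) :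
    t * c ^ m * t⁻¹ * c ^ m * (t * c ^ m * t⁻¹)⁻¹ * (c ^ m)⁻¹ ∈ zpowers (c ^ 2) := by
  have := h.zpowers_sq_normal
  have hmem := h.conj_mul_inv_mem_zpowers_sq h.conj_mem_commutator
  have hmk := QuotientGroup.eq.2 (inv_mul_pow_mem_zpowers_sq (c := c) hm)
  rw [← QuotientGroup.eq_one_iff] at hmem ⊢
  simpa only [QuotientGroup.mk_mul, QuotientGroup.mk_inv, ← hmk] using hmem

theorem conj_conj_pow_mem (h : IsCyclicIndexTwo c t) (hm : Odd m) :
    (c ^ m * (t * c ^ m * t⁻¹))⁻¹ * (t * (t * c ^ m * t⁻¹) * t⁻¹) ∈ zpowers (c ^ 2) := by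
  have := h.zpowers_sq_normal
  have hmem := h.index_eq_three_and_conj.2
  have hmk := QuotientGroup.eq.2 (inv_mul_pow_mem_zpowers_sq (c := c) hm)
  rw [← QuotientGroup.eq_one_iff] at hmem ⊢
  simpa only [QuotientGroup.mk_mul, QuotientGroup.mk_inv, ← hmk] using hmem

theorem quaternion_relations (h : IsCyclicIndexTwo c t) (hm : Odd m)
    (hn : orderOf c = 2 ^ a * m) :
    (c ^ m) ^ 4 = 1 ∧ t * c ^ m * t⁻¹ * c ^ m * (t * c ^ m * t⁻¹)⁻¹ * (c ^ m)⁻¹ = (c ^ m) ^ 2 ∧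
      (c ^ m * (t * c ^ m * t⁻¹))⁻¹ * (t * (t * c ^ m * t⁻¹) * t⁻¹) ∈ zpowers (c ^ m) := by
  have he := h.conj_pow_commutator_mem hm
  have hz := h.conj_conj_pow_mem hm
  have hb : c ^ m ∈ commutator G := pow_mem h.mem_commutator m
  have hb₁ := (inferInstance : (commutator G).Normal).conj_mem _ hb t
  have hsq := h.conj_pow_sq_eq hm hn
  obtain ⟨i, hi⟩ := mem_zpowers_iff.1 hz
  refine quaternion_relations_of_commute (a := a) hm
    (by rw [← orderOf_pow_left hm hn, pow_orderOf_eq_one]) ⟨i, ?_⟩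
    (h.commute_of_mem hb he).symm (h.commute_of_mem hb₁ he).symm (h.commute_of_mem hb hz).symm
    (h.commute_of_mem hb₁ hz).symm (by group) hsq
    (by rw [mul_inv_cancel_left, conj_pow, hsq, ← conj_pow, hsq])
  rw [← hi]
  simp only [← zpow_natCast, ← zpow_mul]
  congr 1
  ring

theorem pow_two_pow_mem_zpowers_sq (h : IsCyclicIndexTwo c t) (hm : Odd m)
    (hn : orderOf c = 2 ^ a * m) : c ^ 2 ^ a ∈ zpowers (c ^ 2) :=
  pow_mem_zpowers_sq (even_two.pow_of_ne_zero (h.ne_zero_of_orderOf_eq hm hn))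

theorem zpowers_sup_closure_eq (h : IsCyclicIndexTwo c t) (hm : Odd m)
    (hn : orderOf c = 2 ^ a * m) :
    zpowers (c ^ 2 ^ a) ⊔ closure {c ^ m, t * c ^ m * t⁻¹} = commutator G := by
  have hZ := h.pow_two_pow_mem_zpowers_sq hm hn
  have hcop : (2 ^ a).Coprime m := (Nat.coprime_two_left.2 hm).pow_left a
  have hD : (commutator G).Normal := inferInstance
  have hcm : c ^ m ∈ commutator G := pow_mem h.mem_commutator m
  refine le_antisymm (sup_le (zpowers_le.2 (pow_mem h.mem_commutator _)) ?_) ?_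
  · rw [closure_le]
    rintro x (rfl | rfl)
    exacts [hcm, hD.conj_mem _ hcm t]
  · refine h.commutator_le
      (mem_of_pow_mem_of_coprime hcop (mem_sup_left (mem_zpowers _))
        (mem_sup_right (subset_closure (by simp))))
      (mem_of_pow_mem_of_coprime hcop (mem_sup_left ?_)
        (mem_sup_right (subset_closure (by simp))))
    obtain ⟨r, hr⟩ := h.exists_conj_sq_eq_zpow
    rw [conj_pow, conj_eq_zpow hr hZ]
    exact zpow_mem (mem_zpowers _) r

theorem closure_normal (h : IsCyclicIndexTwo c t) (hm : Odd m) (hn : orderOf c = 2 ^ a * m) :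
    (closure {c ^ m, t * c ^ m * t⁻¹}).Normal := by
  have hb : c ^ m ∈ closure {c ^ m, t * c ^ m * t⁻¹} := subset_closure (by simp)
  have hb₁ : t * c ^ m * t⁻¹ ∈ closure {c ^ m, t * c ^ m * t⁻¹} := subset_closure (by simp)
  have hZ := h.pow_two_pow_mem_zpowers_sq hm hn
  rw [← normalizer_eq_top_iff]
  refine h.eq_top ?_ (mem_normalizer_closure ?_)
  · rw [← h.zpowers_sup_closure_eq hm hn]
    refine sup_le (zpowers_le.2 (mem_normalizer_closure fun s hs => ?_)) le_normalizer
    have hsD : s ∈ commutator G := by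
      rw [← h.zpowers_sup_closure_eq hm hn]
      exact mem_sup_right (subset_closure hs)
    rw [← (h.commute_of_mem hsD hZ).eq, mul_inv_cancel_right]
    exact subset_closure hs
  · rintro s (rfl | rfl)
    · exact hb₁
    · have hmem := (h.quaternion_relations hm hn).2.2
      have hconj := mul_mem (mul_mem hb hb₁) (zpowers_le.2 hb hmem)
      rwa [mul_inv_cancel_left] at hconj

theorem zpowers_normal_of_mem (h : IsCyclicIndexTwo c t) (hx : x ∈ zpowers (c ^ 2)) :
    (zpowers x).Normal := by
  obtain ⟨r, hr⟩ := h.exists_conj_sq_eq_zpow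
  refine h.zpowers_normal (fun d hd => ?_) ?_
  · rw [(h.commute_of_mem hd hx).eq, mul_inv_cancel_right]
    exact mem_zpowers x
  · rw [conj_eq_zpow hr hx]
    exact zpow_mem (mem_zpowers x) r

/-- Modulo the left-hand side `commutator G` is central in `G`, while it is generated by the
commutators of its elements with elements of `G`. -/
theorem zpowers_zpow_sup_closure_eq (h : IsCyclicIndexTwo c t) (hm : Odd m)
    (hn : orderOf c = 2 ^ a * m) (hr : t * c ^ 2 * t⁻¹ = (c ^ 2) ^ r) :
    zpowers ((c ^ 2 ^ a) ^ (r - 1)) ⊔ closure {c ^ m, t * c ^ m * t⁻¹} = commutator G := by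
  have hZ := h.pow_two_pow_mem_zpowers_sq hm hn
  have := h.closure_normal hm hn
  have := h.zpowers_normal_of_mem (zpow_mem hZ (r - 1))
  set N := zpowers ((c ^ 2 ^ a) ^ (r - 1)) ⊔ closure {c ^ m, t * c ^ m * t⁻¹}
  have hcentralizer : (centralizer {(c ^ 2 ^ a : G ⧸ N)}).comap (QuotientGroup.mk' N) = ⊤ := by
    refine h.eq_top (fun d hd => ?_) ?_
    · exact mem_centralizer_singleton_iff.2
        (congrArg (QuotientGroup.mk' N) (h.commute_of_mem hd hZ).eq)
    · have hmem : (c ^ 2 ^ a) ^ (r - 1) ∈ N := mem_sup_left (mem_zpowers _)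
      rw [zpow_sub_one, ← conj_eq_zpow hr hZ, ← QuotientGroup.eq_one_iff] at hmem
      rw [mem_comap, mem_centralizer_singleton_iff, ← mul_inv_eq_iff_eq_mul, ← mul_inv_eq_one]
      exact hmem
  have hcenter : commutator G ≤ (center (G ⧸ N)).comap (QuotientGroup.mk' N) := by
    rw [← h.zpowers_sup_closure_eq hm hn]
    refine sup_le (zpowers_le.2 (mem_center_iff.2 ?_)) fun x hx => ?_
    · rintro ⟨g⟩
      exact mem_centralizer_singleton_iff.1 (hcentralizer.ge (mem_top g))
    · rw [mem_comap, QuotientGroup.mk'_apply, (QuotientGroup.eq_one_iff x).2 (mem_sup_right hx)]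
      exact one_mem _
  have := h.isCyclic_quotient
  refine le_antisymm ?_ ?_
  · rw [← h.zpowers_sup_closure_eq hm hn]
    exact sup_le_sup_right (zpowers_le.2 (zpow_mem (mem_zpowers _) _)) _
  · rw [← commutator_top_commutator_of_isCyclic_quotient, Subgroup.commutator_le]
    intro g _ d hd
    rw [← QuotientGroup.eq_one_iff, commutatorElement_def]
    exact mul_inv_eq_one.2 (mul_inv_eq_iff_eq_mul.2 (mem_center_iff.1 (hcenter hd) g))

end IsCyclicIndexTwo

end CyclicIndexTwo

/-! ### Admissible groups are semidirect products -/

section SemidirectProduct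

open Subgroup

/-- The homomorphism from the cyclic group of order `n` that sends its standard generator to `g`,
for `g ^ n = 1`. -/
def zmodPowHom {G : Type*} [Group G] {n : ℕ} (g : G) (hg : g ^ n = 1) :
    Multiplicative (ZMod n) →* G :=
  AddMonoidHom.toMultiplicativeLeft
    (ZMod.lift n ⟨zmultiplesHom (Additive G) (Additive.ofMul g), by
      rw [zmultiplesHom_apply, natCast_zsmul, ← ofMul_pow, hg]
      rfl⟩)

section Homs

variable {G : Type*} [Group G]

theorem zmodPowHom_ofAdd_intCast {n : ℕ} (g : G) (hg : g ^ n = 1) (j : ℤ) :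
    zmodPowHom g hg (Multiplicative.ofAdd (j : ZMod n)) = g ^ j := by
  simp [zmodPowHom]

theorem range_zmodPowHom {n : ℕ} (g : G) (hg : g ^ n = 1) :
    (zmodPowHom g hg).range = zpowers g := by
  ext x
  constructor
  · rintro ⟨i, rfl⟩
    obtain ⟨j, hj⟩ := ZMod.intCast_surjective (Multiplicative.toAdd i)
    rw [← ofAdd_toAdd i, ← hj, zmodPowHom_ofAdd_intCast]
    exact zpow_mem (mem_zpowers g) j
  · rintro ⟨j, rfl⟩
    exact ⟨_, zmodPowHom_ofAdd_intCast g hg j⟩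

theorem commute_of_mem_zpowers {g x y : G} (h : Commute g y) (hx : x ∈ zpowers g) :
    Commute x y := by
  obtain ⟨j, rfl⟩ := hx
  exact h.zpow_left j

/-- The homomorphism from the four-group determined by two commuting elements with trivial
squares. -/
def kleinHom (b b₁ : G) (hb : b ^ 2 = 1) (hb₁ : b₁ ^ 2 = 1) (h : Commute b b₁) :
    Multiplicative (ZMod 2) × Multiplicative (ZMod 2) →* G :=
  (zmodPowHom b hb).noncommCoprod (zmodPowHom b₁ hb₁) fun i j =>
    commute_of_mem_zpowers (commute_of_mem_zpowers h.symm (range_zmodPowHom b₁ hb₁ ▸ ⟨j, rfl⟩)).symm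
      (range_zmodPowHom b hb ▸ ⟨i, rfl⟩)

theorem range_kleinHom (b b₁ : G) (hb : b ^ 2 = 1) (hb₁ : b₁ ^ 2 = 1) (h : Commute b b₁) :
    (kleinHom b b₁ hb hb₁ h).range = closure {b, b₁} := by
  rw [kleinHom, MonoidHom.noncommCoprod_range, range_zmodPowHom, range_zmodPowHom,
    zpowers_eq_closure, zpowers_eq_closure, ← Subgroup.closure_union, Set.singleton_union]

/-- The homomorphism from the quaternion group determined by two elements that satisfy the defining
relations. -/
def quaternionHom (b b₁ : G) (hb : b ^ (2 * 2) = 1) (hsq : b₁ ^ 2 = b ^ 2)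
    (hinv : b₁ * b * b₁⁻¹ = b⁻¹) : QuaternionGroup 2 →* G :=
  let f : ZMod (2 * 2) → G := fun i => zmodPowHom b hb (Multiplicative.ofAdd i)
  have hf : ∀ i j, f (i + j) = f i * f j := fun i j => by simp only [f, ofAdd_add, map_mul]
  have hswap : ∀ i, f i * b₁ = b₁ * f (-i) := by
    intro i
    obtain ⟨j, rfl⟩ := ZMod.intCast_surjective i
    have hconj := conj_zpow (a := b₁) (b := b) (i := -j)
    rw [hinv, inv_zpow, zpow_neg, inv_inv, ← zpow_neg, eq_mul_inv_iff_mul_eq] at hconj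
    simpa only [f, ← Int.cast_neg, zmodPowHom_ofAdd_intCast] using hconj
  have hf2 : f 2 = b₁ * b₁ := by
    rw [← sq b₁, hsq]
    exact (zmodPowHom_ofAdd_intCast b hb 2).trans (zpow_ofNat b 2)
  MonoidHom.mk' (fun x => match x with
    | .a i => f i
    | .xa i => b₁ * f i) (by
    rintro (i | i) (j | j)
    · simp only [QuaternionGroup.a_mul_a, hf]
    · simp only [QuaternionGroup.a_mul_xa]
      rw [← mul_assoc, hswap, mul_assoc, ← hf, sub_eq_neg_add]
    · simp only [QuaternionGroup.xa_mul_a, hf, mul_assoc]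
    · simp only [QuaternionGroup.xa_mul_xa]
      rw [mul_assoc b₁, ← mul_assoc (f i), hswap, mul_assoc, ← mul_assoc, ← hf2, ← hf, ← hf]
      congr 1
      push_cast
      ring)

theorem range_quaternionHom (b b₁ : G) (hb : b ^ (2 * 2) = 1) (hsq : b₁ ^ 2 = b ^ 2)
    (hinv : b₁ * b * b₁⁻¹ = b⁻¹) :
    (quaternionHom b b₁ hb hsq hinv).range = closure {b, b₁} := by
  have hbmem : b ∈ closure {b, b₁} := subset_closure (by simp)
  have pow_mem_closure (i : ZMod (2 * 2)) :
      zmodPowHom b hb (Multiplicative.ofAdd i) ∈ closure {b, b₁} :=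
    zpowers_le.2 hbmem (range_zmodPowHom b hb ▸ ⟨_, rfl⟩)
  refine le_antisymm ?_ ((closure_le _).2 ?_)
  · rintro _ ⟨i | i, rfl⟩
    · exact pow_mem_closure i
    · exact mul_mem (subset_closure (by simp)) (pow_mem_closure i)
  · rintro x (rfl | rfl)
    · refine ⟨.a 1, Eq.trans ?_ (zpow_one x)⟩
      rw [← zmodPowHom_ofAdd_intCast x hb, Int.cast_one]
      rfl
    · exact ⟨.xa 0, mul_eq_left.2 (map_one (zmodPowHom b hb))⟩

end Homs

theorem exists_mulEquiv_semidirectProduct {G : Type*} [Group G] {N : Subgroup G} [N.Normal]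
    {N' : Type*} [Group N'] (e : N ≃* N') (hcop : (Nat.card N).Coprime N.index)
    {p : ℕ} [Fact p.Prime] (hidx : N.index = p) :
    ∃ φ : Multiplicative (ZMod p) →* MulAut N',
      Nonempty (G ≃* N' ⋊[φ] Multiplicative (ZMod p)) := by
  obtain ⟨K, hK⟩ := exists_right_complement'_of_coprime hcop
  have hcard : Nat.card K = p := by rw [← hK.symm.index_eq_card, hidx]
  have f : K ≃* Multiplicative (ZMod p) := mulEquivOfPrimeCardEq hcard (by simp)
  exact ⟨_, ⟨(SemidirectProduct.mulEquivSubgroup hK).symm.trans (SemidirectProduct.congr' e f)⟩⟩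

theorem mod_three_eq_one_of_prime_of_dvd {p : ℕ} (hp : p.Prime) {r : ℤ}
    (h3 : (p : ℤ) ∣ r ^ 3 - 1) (h1 : ¬ (p : ℤ) ∣ r - 1) : p % 3 = 1 := by
  have : Fact p.Prime := ⟨hp⟩
  have h3' : (r : ZMod p) ^ 3 = 1 := by
    rw [← sub_eq_zero]
    exact_mod_cast (ZMod.intCast_zmod_eq_zero_iff_dvd _ p).2 h3
  have h1' : (r : ZMod p) ≠ 1 := fun h =>
    h1 ((ZMod.intCast_zmod_eq_zero_iff_dvd _ p).1 (by simp [h]))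
  have hne : (r : ZMod p) ≠ 0 := fun h => by simp [h] at h3'
  have hdvd := ZMod.orderOf_dvd_card_sub_one hne
  rw [orderOf_eq_prime h3' h1'] at hdvd
  have := hp.two_le
  omega

theorem isCoprime_orderOf_of_mem_zpowers_sup {G : Type*} [Group G] {W : Subgroup G} [W.Normal]
    {o : G} {s : ℤ} (hcop : (Nat.card W).Coprime (orderOf o)) (ho : o ∈ zpowers (o ^ s) ⊔ W) :
    IsCoprime s (orderOf o) := by
  obtain ⟨_, ⟨j, rfl⟩, w, hw, hwo⟩ := mem_sup_of_normal_right.1 ho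
  have how : o ^ (1 - s * j) = w := by
    rw [sub_eq_neg_add, zpow_add, zpow_neg, zpow_mul, zpow_one, inv_mul_eq_iff_eq_mul]
    exact hwo.symm
  have hpow : o ^ (1 - s * j) ∈ (⊥ : Subgroup G) := by
    refine mem_of_pow_mem_of_coprime hcop ?_ ?_
    · rw [how, mem_bot]
      exact congrArg Subtype.val (pow_card_eq_one' (x := (⟨w, hw⟩ : W)))
    · rw [mem_bot, ← zpow_natCast, ← zpow_mul, mul_comm, zpow_mul, zpow_natCast,
        pow_orderOf_eq_one, one_zpow]
  obtain ⟨i, hi⟩ := orderOf_dvd_iff_zpow_eq_one.2 hpow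
  exact ⟨j, i, by linear_combination -hi⟩

theorem exists_mulEquiv_prod {G W : Type*} [Group G] [Group W] [Finite W] {D : Subgroup G}
    {o : G} (f : W →* G) (hcomm : ∀ w, Commute o (f w)) (hsup : zpowers o ⊔ f.range = D)
    (hcard : Nat.card D = orderOf o * Nat.card W) (ho : orderOf o ≠ 0) :
    Nonempty (D ≃* Multiplicative (ZMod (orderOf o)) × W) := by
  have : NeZero (orderOf o) := ⟨ho⟩
  let Φ : Multiplicative (ZMod (orderOf o)) × W →* G :=
    (zmodPowHom o (pow_orderOf_eq_one o)).noncommCoprod f fun i w =>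
      commute_of_mem_zpowers (hcomm w) (range_zmodPowHom o (pow_orderOf_eq_one o) ▸ ⟨i, rfl⟩)
  have hΦ : Φ.range = D := by rw [MonoidHom.noncommCoprod_range, range_zmodPowHom, hsup]
  have hbij : Function.Bijective Φ.rangeRestrict := by
    refine Φ.rangeRestrict_surjective.bijective_of_nat_card_le ?_
    rw [hΦ, hcard, Nat.card_prod]
    simp
  rw [← hΦ]
  exact ⟨(MulEquiv.ofBijective _ hbij).symm⟩

variable {G : Type*} [Group G] [Finite G] {c t : G} {a m : ℕ}

theorem IsCyclicIndexTwo.mod_three_eq_one (h : IsCyclicIndexTwo c t) (hm : Odd m)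
    (hn : orderOf c = 2 ^ a * m)
    (hW : Nat.card (closure {c ^ m, t * c ^ m * t⁻¹}) ∣ 2 ^ (a + 1)) {p : ℕ} (hp : p.Prime)
    (hpm : p ∣ m) : p % 3 = 1 := by
  have hZ := h.pow_two_pow_mem_zpowers_sq hm hn
  have := h.closure_normal hm hn
  obtain ⟨r, hr⟩ := h.exists_conj_sq_eq_zpow
  have hom := orderOf_pow_right hn
  have hcop : (Nat.card (closure {c ^ m, t * c ^ m * t⁻¹})).Coprime (orderOf (c ^ 2 ^ a)) :=
    (hom.symm ▸ (Nat.coprime_two_left.2 hm).pow_left (a + 1)).coprime_dvd_left hW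
  have hpm' : (p : ℤ) ∣ m := by exact_mod_cast hpm
  have hr3 := orderOf_dvd_iff_zpow_eq_one.2 (h.zpow_pow_three_sub_one_eq_one hr hZ)
  rw [hom] at hr3
  refine mod_three_eq_one_of_prime_of_dvd hp (hpm'.trans hr3) fun hpr => ?_
  have hr1 : IsCoprime (r - 1) m := hom ▸ isCoprime_orderOf_of_mem_zpowers_sup hcop
    ((h.zpowers_zpow_sup_closure_eq hm hn hr).ge (pow_mem h.mem_commutator _))
  exact (Nat.prime_iff_prime_int.1 hp).not_isUnit (hr1.isUnit_of_dvd' hpr hpm')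

theorem IsCyclicIndexTwo.exists_mulEquiv_prod_semidirectProduct (h : IsCyclicIndexTwo c t)
    (hm : Odd m) (hn : orderOf c = 2 ^ a * m) {W : Type*} [Group W] (f : W →* G)
    (hf : f.range = closure {c ^ m, t * c ^ m * t⁻¹}) (hW : Nat.card W = 2 ^ (a + 1)) :
    (∀ p : ℕ, p.Prime → p ∣ m → p % 3 = 1) ∧
      ∃ φ : Multiplicative (ZMod 3) →* MulAut (Multiplicative (ZMod m) × W),
        Nonempty (G ≃* (Multiplicative (ZMod m) × W) ⋊[φ] Multiplicative (ZMod 3)) := by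
  have hprimes (p : ℕ) (hp : p.Prime) (hpm : p ∣ m) : p % 3 = 1 :=
    h.mod_three_eq_one hm hn (hf ▸ hW ▸ card_range_dvd f) hp hpm
  have hom := orderOf_pow_right hn
  have hidx := h.index_eq_three_and_conj.1
  have hsup := h.zpowers_sup_closure_eq hm hn
  rw [← hf] at hsup
  have hcomm (w : W) : Commute (c ^ 2 ^ a) (f w) :=
    (h.commute_of_mem (hsup.le (mem_sup_right ⟨w, rfl⟩)) (h.pow_two_pow_mem_zpowers_sq hm hn)).symm
  have : Finite W := Nat.finite_of_card_ne_zero (hW ▸ by positivity)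
  have hcard : Nat.card (commutator G) = m * 2 ^ (a + 1) := by
    rw [← relIndex_bot_left, ← relIndex_mul_relIndex ⊥ _ _ bot_le h.zpowers_le_commutator,
      relIndex_bot_left, h.relIndex_eq_two, Nat.card_zpowers, hn]
    ring
  have ⟨e⟩ := exists_mulEquiv_prod f hcomm hsup (by rw [hom, hW, hcard]) (hom ▸ hm.pos.ne')
  rw [hom] at e
  have : Fact (Nat.Prime 3) := ⟨Nat.prime_three⟩
  refine ⟨hprimes, exists_mulEquiv_semidirectProduct e ?_ hidx⟩
  rw [hidx, hcard]
  refine Nat.Coprime.mul_left ?_ (Nat.Coprime.pow_left _ (by norm_num))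
  rw [Nat.coprime_comm, Nat.prime_three.coprime_iff_not_dvd]
  exact fun hdvd => absurd (hprimes 3 Nat.prime_three hdvd) (by norm_num)

theorem IsCyclicIndexTwo.isKleinType {G : Type u} [Group G] [Finite G] {c t : G}
    (h : IsCyclicIndexTwo c t) (hm : Odd m) (hn : orderOf c = 2 ^ 1 * m) :
    (∀ p : ℕ, p.Prime → p ∣ m → p % 3 = 1) ∧ IsKleinType m G := by
  have hb : (c ^ m) ^ 2 = 1 :=
    orderOf_dvd_iff_pow_eq_one.1 (orderOf_pow_left hm hn).dvd
  have hb₁ := (h.conj_pow_sq_eq hm hn).trans hb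
  have hcomm : Commute (c ^ m) (t * c ^ m * t⁻¹) := by
    have hcommutator := (h.quaternion_relations hm hn).2.1
    rw [hb, mul_inv_eq_one, mul_inv_eq_iff_eq_mul] at hcommutator
    exact hcommutator.symm
  exact h.exists_mulEquiv_prod_semidirectProduct hm hn _ (range_kleinHom _ _ hb hb₁ hcomm) (by simp)

theorem IsCyclicIndexTwo.isQuaternionType {G : Type u} [Group G] [Finite G] {c t : G}
    (h : IsCyclicIndexTwo c t) (hm : Odd m) (hn : orderOf c = 2 ^ 2 * m) :
    (∀ p : ℕ, p.Prime → p ∣ m → p % 3 = 1) ∧ IsQuaternionType m G := by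
  obtain ⟨hb, hcomm, -⟩ := h.quaternion_relations hm hn
  have hinv : t * c ^ m * t⁻¹ * c ^ m * (t * c ^ m * t⁻¹)⁻¹ = (c ^ m)⁻¹ := by
    rw [mul_inv_eq_iff_eq_mul.1 hcomm, ← pow_succ]
    exact eq_inv_of_mul_eq_one_left (by rw [← pow_succ, hb])
  exact h.exists_mulEquiv_prod_semidirectProduct hm hn _
    (range_quaternionHom _ _ hb (h.conj_pow_sq_eq hm hn) hinv)
    (by rw [Nat.card_eq_fintype_card, QuaternionGroup.card]; norm_num)

theorem IsCyclicIndexTwo.isKleinType_or_isQuaternionType {k : ℕ} {G : Type u} [Group G] [Finite G]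
    {c t : G} (h : IsCyclicIndexTwo c t) (hord : orderOf c = k + 1) :
    (k % 4 = 1 ∧ (∀ p : ℕ, p.Prime → p ∣ (k + 1) / 2 → p % 3 = 1) ∧ IsKleinType ((k + 1) / 2) G) ∨
      (k % 4 = 3 ∧ (∀ p : ℕ, p.Prime → p ∣ (k + 1) / 4 → p % 3 = 1) ∧
        IsQuaternionType ((k + 1) / 4) G) := by
  obtain ⟨a, m, hm, hn⟩ := Nat.exists_eq_two_pow_mul_odd (orderOf_pos c).ne'
  have ha0 := h.ne_zero_of_orderOf_eq hm hn
  have ha2 : a ≤ 2 := by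
    have hdvd := orderOf_dvd_iff_pow_eq_one.2 (h.quaternion_relations hm hn).1
    rw [orderOf_pow_left hm hn] at hdvd
    exact (Nat.pow_dvd_pow_iff_le_right' (b := 0)).1 hdvd
  obtain ⟨w, hw⟩ := hm
  obtain rfl | rfl : a = 1 ∨ a = 2 := by omega
  · left
    rw [show (k + 1) / 2 = m by omega]
    exact ⟨by omega, h.isKleinType ⟨w, hw⟩ hn⟩
  · right
    rw [show (k + 1) / 4 = m by omega]
    exact ⟨by omega, h.isQuaternionType ⟨w, hw⟩ hn⟩

end SemidirectProduct

section Admissible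

open Subgroup

namespace IsAdmissible

variable {k q : ℕ} {G : Type u} [Group G] {x y : G}

theorem finite (h : IsAdmissible k q G x y) (hq : q.Prime) : Finite G := by
  have := hq.pos
  exact Nat.finite_of_card_ne_zero (by rw [h.1]; positivity)

theorem commutator_mem (x y : G) : x * y * x⁻¹ * y⁻¹ ∈ commutator G :=
  commutator_mem_commutator (mem_top x) (mem_top y)

theorem index_zpowers (h : IsAdmissible k q G x y) :
    (zpowers (x * y * x⁻¹ * y⁻¹)).index = 2 * q := by
  have hmul := (zpowers (x * y * x⁻¹ * y⁻¹)).card_mul_index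
  rw [Nat.card_zpowers, h.2.2, h.1] at hmul
  exact Nat.eq_of_mul_eq_mul_left (show 0 < k + 1 by omega) (by rw [hmul]; ring)

theorem isCyclic_quotient (h : IsAdmissible k q G x y) (hq : q.Prime) (hq2 : q ≠ 2) :
    IsCyclic (G ⧸ commutator G) := by
  have hsqf : Squarefree (2 * q) := by
    rw [Nat.squarefree_mul ((Nat.coprime_primes Nat.prime_two hq).2 hq2.symm)]
    exact ⟨Nat.prime_two.prime.squarefree, hq.prime.squarefree⟩
  have hdvd : (commutator G).index ∣ 2 * q :=
    h.index_zpowers ▸ index_dvd_of_le (zpowers_le.2 (commutator_mem x y))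
  have := h.finite hq
  have : IsZGroup (Abelianization G) :=
    IsZGroup.of_squarefree (hsqf.squarefree_of_dvd ((index_eq_card _).symm.dvd.trans hdvd))
  exact (inferInstance : IsCyclic (Abelianization G))

theorem index_commutator (hk : Odd k) (hq : q.Prime) (hq2 : q ≠ 2)
    (h : IsAdmissible k q G x y) :
    (commutator G).index = q ∧ (zpowers (x * y * x⁻¹ * y⁻¹)).relIndex (commutator G) = 2 := by
  have := h.finite hq
  have := h.isCyclic_quotient hq hq2
  have hidx := h.index_zpowers
  have heven : Even ((zpowers (x * y * x⁻¹ * y⁻¹)).relIndex (commutator G)) :=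
    even_relIndex_zpowers_commutator (commutator_mem x y) (h.2.2 ▸ hk.add_one)
  have hmul := relIndex_mul_index (zpowers_le.2 (commutator_mem x y))
  rw [hidx] at hmul
  rcases eq_of_dvd_two_mul_prime hq (Dvd.intro_left _ hmul) with h1 | h1 | h1 | h1
  · have hperfect : Group.IsPerfect G := ⟨index_eq_one.1 h1⟩
    exact absurd hperfect (not_isPerfect_of_index_zpowers hq hq2 hidx)
  · rw [h1, mul_comm] at hmul
    rw [Nat.eq_of_mul_eq_mul_left two_pos hmul] at heven
    exact absurd heven (Nat.not_even_iff_odd.2 (hq.odd_of_ne_two hq2))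
  · rw [h1] at hmul
    exact ⟨h1, Nat.eq_of_mul_eq_mul_right hq.pos hmul⟩
  · rw [h1] at hmul
    rw [Nat.eq_of_mul_eq_mul_right (mul_pos two_pos hq.pos) (hmul.trans (one_mul _).symm)] at heven
    exact absurd heven Nat.not_even_one

theorem eq_three_and_type (hk : Odd k) (hq : q.Prime) (hq2 : q ≠ 2)
    (h : IsAdmissible k q G x y) :
    q = 3 ∧
      ((k % 4 = 1 ∧ (∀ p : ℕ, p.Prime → p ∣ (k + 1) / 2 → p % 3 = 1) ∧
          IsKleinType ((k + 1) / 2) G) ∨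
        (k % 4 = 3 ∧ (∀ p : ℕ, p.Prime → p ∣ (k + 1) / 4 → p % 3 = 1) ∧
          IsQuaternionType ((k + 1) / 4) G)) := by
  obtain ⟨hidx, hrel⟩ := h.index_commutator hk hq hq2
  have := h.finite hq
  obtain ⟨t, ht⟩ : ∃ t, t ∉ commutator G := by
    by_contra! hmem
    rw [index_eq_one.2 (eq_top_iff' _ |>.2 hmem)] at hidx
    exact hq.one_lt.ne hidx
  have hcyclic : IsCyclicIndexTwo (x * y * x⁻¹ * y⁻¹) t :=
    ⟨hidx ▸ hq, hidx ▸ hq2, commutator_mem x y, hrel, ht⟩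
  exact ⟨hidx.symm.trans hcyclic.index_eq_three_and_conj.1,
    hcyclic.isKleinType_or_isQuaternionType h.2.2⟩

end IsAdmissible

end Admissible

/-! ### Construction of admissible pairs -/

section CubeRoots

theorem isUnit_or_isNilpotent {p n : ℕ} (hp : p.Prime) (hn : 0 < n) (x : ZMod (p ^ n)) :
    IsUnit x ∨ IsNilpotent x := by
  have : NeZero (p ^ n) := ⟨pow_ne_zero n hp.ne_zero⟩
  obtain ⟨m, rfl⟩ := ZMod.natCast_zmod_surjective x
  rw [ZMod.isUnit_iff_coprime, Nat.coprime_pow_right_iff hn, Nat.coprime_comm,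
    hp.coprime_iff_not_dvd]
  refine (em (p ∣ m)).symm.imp_right fun h => ⟨n, ?_⟩
  rw [← Nat.cast_pow, ZMod.natCast_eq_zero_iff]
  exact pow_dvd_pow_of_dvd h n

theorem sq_add_self_add_one_eq_zero_of_pow_three {R : Type*} [CommRing R] {r : R} (hr : r ^ 3 = 1)
    (hr1 : r ≠ 1) (h3 : IsUnit (3 : R)) (h : IsUnit (r - 1) ∨ IsNilpotent (r - 1)) :
    r ^ 2 + r + 1 = 0 := by
  have hprod : (r - 1) * (r ^ 2 + r + 1) = 0 := by linear_combination hr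
  rcases h with hunit | hnil
  · exact hunit.mul_right_eq_zero.1 hprod
  · have hsum : IsUnit (r ^ 2 + r + 1) := by
      rw [show r ^ 2 + r + 1 = 3 + (r - 1) * (r + 2) by ring]
      exact ((Commute.all _ _).isNilpotent_mul_right hnil).isUnit_add_left_of_commute h3
        (Commute.all _ _)
    exact absurd (sub_eq_zero.1 (hsum.mul_left_eq_zero.1 hprod)) hr1

theorem exists_sq_add_self_add_one_eq_zero_of_prime_pow {p n : ℕ} (hp : p.Prime) (hn : 0 < n)
    (hp3 : p % 3 = 1) : ∃ r : ZMod (p ^ n), r ^ 2 + r + 1 = 0 := by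
  have : Fact p.Prime := ⟨hp⟩
  have : Fact (Nat.Prime 3) := ⟨Nat.prime_three⟩
  have hcard : 3 ∣ Nat.card (ZMod (p ^ n))ˣ := by
    rw [Nat.card_eq_fintype_card, ZMod.card_units_eq_totient, Nat.totient_prime_pow hp hn]
    exact dvd_mul_of_dvd_right (by omega) _
  obtain ⟨w, hw⟩ := exists_prime_orderOf_dvd_card' 3 hcard
  have hw3 : (w : ZMod (p ^ n)) ^ 3 = 1 := by
    rw [← Units.val_pow_eq_pow_val, ← hw, pow_orderOf_eq_one, Units.val_one]
  have hw1 : (w : ZMod (p ^ n)) ≠ 1 := fun h => by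
    rw [Units.val_eq_one.1 h, orderOf_one] at hw
    omega
  have h3 : IsUnit (3 : ZMod (p ^ n)) := by
    refine mod_cast (ZMod.isUnit_prime_iff_not_dvd Nat.prime_three).2 fun h => ?_
    have := (Nat.prime_dvd_prime_iff_eq Nat.prime_three hp).1 (Nat.prime_three.dvd_of_dvd_pow h)
    omega
  exact ⟨w, sq_add_self_add_one_eq_zero_of_pow_three hw3 hw1 h3 (isUnit_or_isNilpotent hp hn _)⟩

theorem exists_sq_add_self_add_one_eq_zero {l : ℕ} (hl : l ≠ 0)
    (h : ∀ p : ℕ, p.Prime → p ∣ l → p % 3 = 1) : ∃ r : ZMod l, r ^ 2 + r + 1 = 0 := by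
  induction l using Nat.recOnPosPrimePosCoprime with
  | zero => exact absurd rfl hl
  | one => exact ⟨0, Subsingleton.elim _ _⟩
  | prime_pow p n hp hn =>
    exact exists_sq_add_self_add_one_eq_zero_of_prime_pow hp hn (h p hp (dvd_pow_self p hn.ne'))
  | coprime a b ha hb hab iha ihb =>
    obtain ⟨s, hs⟩ := iha (by omega) fun p hp hpa => h p hp (hpa.mul_right b)
    obtain ⟨t, ht⟩ := ihb (by omega) fun p hp hpb => h p hp (hpb.mul_left a)
    let e := ZMod.chineseRemainder hab
    refine ⟨e.symm (s, t), e.injective ?_⟩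
    rw [map_add, map_add, map_pow, map_one, map_zero, e.apply_symm_apply]
    exact Prod.ext hs ht

theorem addOrderOf_eq_of_isUnit {l : ℕ} {r : ZMod l} (hr : IsUnit r) : addOrderOf r = l := by
  obtain ⟨u, rfl⟩ := hr
  rw [← mul_one (u : ZMod l), ← AddMonoidHom.coe_mulLeft,
    addOrderOf_injective _ (fun _ _ => u.mul_right_inj.1), ZMod.addOrderOf_one]

end CubeRoots

section MulAut

open Subgroup

theorem IsAdmissible.of_mulEquiv {k q : ℕ} {G G' : Type*} [Group G] [Group G'] (e : G ≃* G')
    {x y : G} (h : IsAdmissible k q G x y) : IsAdmissible k q G' (e x) (e y) := by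
  obtain ⟨hcard, hgen, hord⟩ := h
  refine ⟨(Nat.card_congr e.toEquiv).symm.trans hcard, ?_, ?_⟩
  · rw [← Set.image_pair, ← MulEquiv.coe_toMonoidHom, ← MonoidHom.map_closure, hgen,
      map_top_of_surjective _ e.surjective]
  · rw [← map_inv, ← map_inv, ← map_mul, ← map_mul, ← map_mul, e.orderOf_eq, hord]

section Semidirect

variable {N : Type*} [Group N] (α : MulAut N)

theorem inr_mul_inl_mul_inv_inr (n : N) :
    (SemidirectProduct.inr ⟨α, mem_zpowers α⟩ * SemidirectProduct.inl n *
        (SemidirectProduct.inr ⟨α, mem_zpowers α⟩)⁻¹ : N ⋊[(zpowers α).subtype] zpowers α) =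
      SemidirectProduct.inl (α n) := by
  rw [← map_inv]
  exact (SemidirectProduct.inl_aut (φ := (zpowers α).subtype) ⟨α, mem_zpowers α⟩ n).symm

theorem closure_inr_inl_eq_top (v : N)
    (hgen : ∀ V : Subgroup N, v ∈ V → (∀ n ∈ V, α n ∈ V) → V = ⊤) :
    closure {(SemidirectProduct.inr ⟨α, mem_zpowers α⟩ : N ⋊[(zpowers α).subtype] zpowers α),
      SemidirectProduct.inl v} = ⊤ := by
  set U := closure {(SemidirectProduct.inr ⟨α, mem_zpowers α⟩ :
    N ⋊[(zpowers α).subtype] zpowers α), SemidirectProduct.inl v}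
  have hα : SemidirectProduct.inr ⟨α, mem_zpowers α⟩ ∈ U := subset_closure (by simp)
  have hN : U.comap SemidirectProduct.inl = ⊤ := by
    refine hgen _ (subset_closure (by simp)) fun n hn => ?_
    rw [mem_comap, ← inr_mul_inl_mul_inv_inr]
    exact mul_mem (mul_mem hα hn) (inv_mem hα)
  refine eq_top_iff.2 fun g _ => ?_
  obtain ⟨j, hj⟩ := mem_zpowers_iff.1 g.right.2
  rw [← SemidirectProduct.inl_left_mul_inr_right g,
    show g.right = ⟨α, mem_zpowers α⟩ ^ j from Subtype.ext hj.symm, map_zpow]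
  exact mul_mem (hN.ge (mem_top g.left)) (zpow_mem hα j)

theorem isAdmissible_inr_inl {k : ℕ} (v : N)
    (hgen : ∀ V : Subgroup N, v ∈ V → (∀ n ∈ V, α n ∈ V) → V = ⊤)
    (hcard : Nat.card N = 2 * (k + 1)) (hord : orderOf (α v * v⁻¹) = k + 1) :
    IsAdmissible k (orderOf α) (N ⋊[(zpowers α).subtype] zpowers α)
      (SemidirectProduct.inr ⟨α, mem_zpowers α⟩) (SemidirectProduct.inl v) := by
  refine ⟨?_, closure_inr_inl_eq_top α v hgen, ?_⟩
  · rw [SemidirectProduct.card, Nat.card_zpowers, hcard]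
  · rw [inr_mul_inl_mul_inv_inr, ← map_inv, ← map_mul,
      orderOf_injective _ SemidirectProduct.inl_injective, hord]

end Semidirect

theorem mk_one_mem_and_one_mk_mem {M W : Type*} [Group M] [Group W] {V : Subgroup (M × W)} {z : M}
    {w : W} (h : (orderOf z).Coprime (orderOf w)) (hzw : (z, w) ∈ V) :
    (z, 1) ∈ V ∧ (1, w) ∈ V := by
  obtain ⟨s, hsz, hsw⟩ := Nat.chineseRemainder h 1 0
  have hz : (z, (1 : W)) ∈ V := by
    have hpow : (z, w) ^ s = (z, 1) := by
      rw [Prod.pow_mk, pow_eq_pow_iff_modEq.2 hsz, pow_eq_pow_iff_modEq.2 hsw, pow_one, pow_zero]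
    exact hpow ▸ pow_mem hzw s
  refine ⟨hz, ?_⟩
  have := mul_mem (inv_mem hz) hzw
  rwa [Prod.inv_mk, Prod.mk_mul_mk, inv_mul_cancel, inv_one, one_mul] at this

theorem prodCongr_pow {M W : Type*} [Group M] [Group W] (γ : MulAut M) (β : MulAut W) (n : ℕ) :
    (MulEquiv.prodCongr γ β : MulAut (M × W)) ^ n = MulEquiv.prodCongr (γ ^ n) (β ^ n) := by
  induction n with
  | zero => rfl
  | succ n ih => rw [pow_succ, pow_succ, pow_succ, ih]; rfl

theorem eq_top_of_prodCongr_mem {M W : Type*} [Group M] [Group W] {γ : MulAut M} {β : MulAut W}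
    {z : M} {v : W} (hM : zpowers z = ⊤) (hW : closure {v, β v} = ⊤)
    (hcop : (orderOf z).Coprime (orderOf v)) {V : Subgroup (M × W)} (hzv : (z, v) ∈ V)
    (hV : ∀ n ∈ V, MulEquiv.prodCongr γ β n ∈ V) : V = ⊤ := by
  obtain ⟨hz, hv⟩ := mk_one_mem_and_one_mk_mem hcop hzv
  have hβv : (1, β v) ∈ V := by
    have := hV _ hv
    rwa [show MulEquiv.prodCongr γ β (1, v) = (γ 1, β v) from rfl, map_one] at this
  have hleft : V.comap (MonoidHom.inl M W) = ⊤ :=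
    top_le_iff.1 (hM ▸ zpowers_le.2 hz)
  have hright : V.comap (MonoidHom.inr M W) = ⊤ :=
    top_le_iff.1 (hW ▸ (closure_le _).2 (Set.pair_subset hv hβv))
  refine eq_top_iff.2 fun n _ => ?_
  have hn₁ : (n.1, 1) ∈ V := hleft.ge (mem_top n.1)
  have hn₂ : (1, n.2) ∈ V := hright.ge (mem_top n.2)
  simpa only [Prod.mk_mul_mk, mul_one, one_mul] using mul_mem hn₁ hn₂

theorem exists_mulAut_multiplicative_zmod {l : ℕ} (hl : l ≠ 0)
    (h : ∀ p : ℕ, p.Prime → p ∣ l → p % 3 = 1) :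
    ∃ γ : MulAut (Multiplicative (ZMod l)), γ ^ 3 = 1 ∧
      orderOf (γ (Multiplicative.ofAdd 1) * (Multiplicative.ofAdd 1)⁻¹) = l := by
  obtain ⟨r, hr⟩ := exists_sq_add_self_add_one_eq_zero hl h
  let ρ : (ZMod l)ˣ :=
    ⟨r, r ^ 2, by linear_combination (r - 1) * hr, by linear_combination (r - 1) * hr⟩
  let γ : MulAut (Multiplicative (ZMod l)) := AddEquiv.toMultiplicative (AddAut.mulLeft ρ)
  have hγ (z : ZMod l) : γ (Multiplicative.ofAdd z) = Multiplicative.ofAdd (r * z) := rfl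
  refine ⟨γ, ?_, ?_⟩
  · ext z
    change γ (γ (γ (Multiplicative.ofAdd z.toAdd))) = Multiplicative.ofAdd z.toAdd
    rw [hγ, hγ, hγ]
    exact congrArg Multiplicative.ofAdd (by linear_combination (r - 1) * z.toAdd * hr)
  · -- `r - 1` is a unit because `(r - 1) * (r + 2) = -3`.
    have h3 : IsUnit (-3 : ZMod l) := by
      refine IsUnit.neg (mod_cast (ZMod.isUnit_prime_iff_not_dvd Nat.prime_three).2 fun h3 => ?_)
      have := h 3 Nat.prime_three h3
      omega
    have hunit : IsUnit (r - 1) := isUnit_of_mul_isUnit_left (y := r + 2) <| by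
      rwa [show (r - 1) * (r + 2) = -3 by linear_combination hr]
    rw [hγ, mul_one, ← ofAdd_neg, ← ofAdd_add, ← sub_eq_add_neg, orderOf_ofAdd_eq_addOrderOf,
      addOrderOf_eq_of_isUnit hunit]

theorem exists_isAdmissible_of_mulAut {k l e : ℕ} {W : Type u} [Group W] {β : MulAut W}
    (hβ : orderOf β = 3) {v : W} (hgen : closure {v, β v} = ⊤) (he : orderOf (β v * v⁻¹) = e)
    (hcard : Nat.card W = 2 * e) (hlW : l.Coprime (Nat.card W))
    (hl3 : ∀ p : ℕ, p.Prime → p ∣ l → p % 3 = 1) (hk : k + 1 = l * e) :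
    ∃ (G : Type u) (_ : Group G) (x y : G), IsAdmissible k 3 G x y := by
  have hl : l ≠ 0 := left_ne_zero_of_mul (hk ▸ k.add_one_ne_zero)
  obtain ⟨γ, hγ, hγl⟩ := exists_mulAut_multiplicative_zmod hl hl3
  let α : MulAut (Multiplicative (ZMod l) × W) := MulEquiv.prodCongr γ β
  have hα : orderOf α = 3 := by
    have : Fact (Nat.Prime 3) := ⟨Nat.prime_three⟩
    refine orderOf_eq_prime ?_ fun h => ?_
    · rw [prodCongr_pow, hγ, ← hβ, pow_orderOf_eq_one]
      rfl
    · have : β = 1 := MulEquiv.ext fun w => congrArg Prod.snd (DFunLike.congr_fun h (1, w))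
      rw [this, orderOf_one] at hβ
      omega
  have hz : zpowers (Multiplicative.ofAdd (1 : ZMod l)) = ⊤ := by
    refine eq_top_iff.2 fun z _ => ?_
    obtain ⟨j, hj⟩ := ZMod.intCast_surjective z.toAdd
    exact mem_zpowers_iff.2 ⟨j, by rw [← ofAdd_toAdd z, ← hj, ← ofAdd_zsmul, zsmul_one]⟩
  have hzord : orderOf (Multiplicative.ofAdd (1 : ZMod l)) = l := by
    rw [orderOf_ofAdd_eq_addOrderOf, ZMod.addOrderOf_one]
  rw [← hα]
  refine ⟨_, inferInstance, _, _, isAdmissible_inr_inl α (Multiplicative.ofAdd 1, v) ?_ ?_ ?_⟩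
  · refine fun V hV => eq_top_of_prodCongr_mem hz hgen ?_ hV
    rw [hzord]
    exact hlW.coprime_dvd_right (orderOf_dvd_natCard v)
  · rw [Nat.card_prod, hcard, hk, Nat.card_congr Multiplicative.toAdd, Nat.card_zmod]
    ring
  · rw [Prod.inv_mk]
    change orderOf (γ _ * _, β v * v⁻¹) = _
    rw [Prod.orderOf_mk, hγl, he, hk]
    exact (hlW.coprime_dvd_right ⟨2, by rw [hcard, mul_comm]⟩).lcm_eq_mul

/-- An automorphism of order three of the four-group. -/
def kleinAut : MulAut (Multiplicative (ZMod 2) × Multiplicative (ZMod 2)) where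
  toFun x := (x.2, x.1 * x.2)
  invFun x := (x.1 * x.2, x.1)
  left_inv := by decide
  right_inv := by decide
  map_mul' := by decide

/-- The map underlying an automorphism of order three of the quaternion group; it permutes
`i = a 1`, `j = xa 0` and `i * j = xa 3` cyclically. -/
def quaternionRotation : QuaternionGroup 2 → QuaternionGroup 2
  | .a i => if i = 0 then .a 0 else if i = 1 then .xa 0 else if i = 2 then .a 2 else .xa 2
  | .xa i => if i = 0 then .xa 3 else if i = 1 then .a 3 else if i = 2 then .xa 1 else .a 1

theorem quaternionRotation_mul (x y : QuaternionGroup 2) :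
    quaternionRotation (x * y) = quaternionRotation x * quaternionRotation y := by
  rcases x with i | i <;> rcases y with j | j <;> revert i j <;> decide

theorem quaternionRotation_rotation_rotation (x : QuaternionGroup 2) :
    quaternionRotation (quaternionRotation (quaternionRotation x)) = x := by
  rcases x with i | i <;> revert i <;> decide

/-- An automorphism of order three of the quaternion group. -/
def quaternionAut : MulAut (QuaternionGroup 2) where
  toFun := quaternionRotation
  invFun x := quaternionRotation (quaternionRotation x)
  left_inv := quaternionRotation_rotation_rotation
  right_inv := quaternionRotation_rotation_rotation
  map_mul' := quaternionRotation_mul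

theorem orderOf_kleinAut : orderOf kleinAut = 3 :=
  have : Fact (Nat.Prime 3) := ⟨Nat.prime_three⟩
  orderOf_eq_prime (MulEquiv.ext (by decide)) fun h =>
    absurd (DFunLike.congr_fun h (Multiplicative.ofAdd 1, 1)) (by decide)

theorem orderOf_quaternionAut : orderOf quaternionAut = 3 :=
  have : Fact (Nat.Prime 3) := ⟨Nat.prime_three⟩
  orderOf_eq_prime (MulEquiv.ext quaternionRotation_rotation_rotation) fun h =>
    absurd (DFunLike.congr_fun h (.a 1)) (by decide)

theorem closure_kleinAut_eq_top :
    Subgroup.closure {(Multiplicative.ofAdd 1, 1), kleinAut (Multiplicative.ofAdd 1, 1)} = ⊤ := by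
  have hx : ∀ x : Multiplicative (ZMod 2) × Multiplicative (ZMod 2), ∃ i j : Fin 2,
      x = (Multiplicative.ofAdd 1, 1) ^ i.1 * kleinAut (Multiplicative.ofAdd 1, 1) ^ j.1 := by
    decide
  refine eq_top_iff.2 fun x _ => ?_
  obtain ⟨i, j, rfl⟩ := hx x
  exact mul_mem (pow_mem (subset_closure (by simp)) _) (pow_mem (subset_closure (by simp)) _)

theorem closure_quaternionAut_eq_top :
    closure {QuaternionGroup.a 1, quaternionAut (.a 1)} = ⊤ := by
  have hx : ∀ x : QuaternionGroup 2, ∃ (i : Fin 2) (j : Fin 4),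
      x = quaternionAut (.a 1) ^ i.1 * .a 1 ^ j.1 := by
    rintro (i | i) <;> revert i <;> decide
  refine eq_top_iff.2 fun x _ => ?_
  obtain ⟨i, j, rfl⟩ := hx x
  exact mul_mem (pow_mem (subset_closure (by simp)) _) (pow_mem (subset_closure (by simp)) _)

theorem coprime_two_of_forall_mod_three {l : ℕ} (h : ∀ p : ℕ, p.Prime → p ∣ l → p % 3 = 1) :
    l.Coprime 2 :=
  (Nat.Coprime.symm <| (Nat.Prime.coprime_iff_not_dvd Nat.prime_two).2 fun h2 =>
    absurd (h 2 Nat.prime_two h2) (by decide))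

theorem exists_isAdmissible_of_arithCondition {k q : ℕ} (h : ArithCondition k q) :
    ∃ (G : Type u) (_ : Group G) (x y : G), IsAdmissible k q G x y := by
  obtain ⟨rfl, h⟩ := h
  suffices ∃ (G : Type) (_ : Group G) (x y : G), IsAdmissible k 3 G x y by
    obtain ⟨G, _, x, y, hG⟩ := this
    exact ⟨ULift G, inferInstance, _, _, hG.of_mulEquiv MulEquiv.ulift.symm⟩
  rcases h with ⟨hk, hl⟩ | ⟨hk, hl⟩
  · have hcard : Nat.card (Multiplicative (ZMod 2) × Multiplicative (ZMod 2)) = 2 ^ 2 := by simp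
    have he : orderOf (kleinAut (Multiplicative.ofAdd 1, 1) * (Multiplicative.ofAdd 1, 1)⁻¹) = 2 :=
      orderOf_eq_prime_iff.2 (by decide)
    exact exists_isAdmissible_of_mulAut orderOf_kleinAut closure_kleinAut_eq_top he
      (by omega) (hcard ▸ (coprime_two_of_forall_mod_three hl).pow_right 2) hl (by omega)
  · have hcard : Nat.card (QuaternionGroup 2) = 2 ^ 3 := by
      rw [Nat.card_eq_fintype_card, QuaternionGroup.card]
      norm_num
    have he : orderOf (quaternionAut (.a 1) * (.a 1)⁻¹) = 4 :=
      QuaternionGroup.orderOf_xa (n := 2) _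
    exact exists_isAdmissible_of_mulAut orderOf_quaternionAut closure_quaternionAut_eq_top he
      (by omega) (hcard ▸ (coprime_two_of_forall_mod_three hl).pow_right 3) hl (by omega)

end MulAut

/-! ### The topology of the surface of an origami -/

namespace Origami

open unitInterval

variable {S : Type u} (O : Origami S)

/-- The point of the surface with coordinates `(x, y)` in the square `s`. -/
def pt (s : S) (x y : I) : O.Surface := Quot.mk O.Glue ⟨s, (x, y)⟩

theorem pt_one_left (s : S) (y : I) : O.pt s 1 y = O.pt (O.right s) 0 y :=
  Quot.sound (Glue.right s y)

theorem pt_one_right (s : S) (x : I) : O.pt s x 1 = O.pt (O.up s) x 0 :=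
  Quot.sound (Glue.up s x)

theorem proj_pt (s : S) (x y : I) :
    O.proj (O.pt s x y) = (((x : ℝ) : UnitAddCircle), ((y : ℝ) : UnitAddCircle)) := rfl

theorem continuous_pt (s : S) : Continuous fun z : I × I => O.pt s z.1 z.2 := by
  have : Continuous (Quot.mk O.Glue) := continuous_quot_mk
  exact this.comp (@continuous_sigmaMk S (fun _ => I × I) _ s)

theorem continuous_proj : Continuous O.proj := by
  refine continuous_quot_lift _ (continuous_sigma_iff.2 fun s => ?_)
  have h : Continuous fun x : ℝ => (x : UnitAddCircle) := AddCircle.continuous_mk' 1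
  exact (h.comp (continuous_subtype_val.comp continuous_fst)).prodMk
    (h.comp (continuous_subtype_val.comp continuous_snd))

theorem exists_pt (P : O.Surface) : ∃ s x y, x ≠ 1 ∧ y ≠ 1 ∧ P = O.pt s x y := by
  obtain ⟨⟨s, x, y⟩, rfl⟩ := Quot.exists_rep P
  obtain ⟨s', x', hx', hs'⟩ : ∃ s' x', x' ≠ 1 ∧ O.pt s x y = O.pt s' x' y := by
    by_cases hx : x = 1
    · exact ⟨O.right s, 0, zero_ne_one, by rw [hx, pt_one_left]⟩
    · exact ⟨s, x, hx, rfl⟩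
  by_cases hy : y = 1
  · exact ⟨O.up s', x', 0, hx', zero_ne_one, by rw [← pt_one_right, ← hy]; exact hs'⟩
  · exact ⟨s', x', y, hx', hy, hs'⟩

theorem eq_of_coe_unitAddCircle_eq {x x' : I} (hx : x ≠ 1) (hx' : x' ≠ 1)
    (h : ((x' : ℝ) : UnitAddCircle) = ((x : ℝ) : UnitAddCircle)) : x' = x := by
  have hmem : ∀ {z : I}, z ≠ 1 → (z : ℝ) ∈ Set.Ico (0 : ℝ) (0 + 1) := fun {z} hz =>
    ⟨z.2.1, by simpa using unitInterval.lt_one_iff_ne_one.2 hz⟩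
  rw [AddCircle.coe_eq_coe_iff_of_mem_Ico (hmem hx') (hmem hx)] at h
  exact Subtype.ext h

theorem eq_or_of_coe_unitAddCircle_eq {x x' : I} (hx : x ≠ 1)
    (h : ((x' : ℝ) : UnitAddCircle) = ((x : ℝ) : UnitAddCircle)) : x' = x ∨ x' = 1 ∧ x = 0 := by
  by_cases hx' : x' = 1
  · refine Or.inr ⟨hx', (eq_of_coe_unitAddCircle_eq hx zero_ne_one ?_).symm⟩
    rw [← h, hx']
    exact (AddCircle.coe_period (1 : ℝ)).symm
  · exact Or.inl (eq_of_coe_unitAddCircle_eq hx hx' h)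

theorem exists_pt_of_proj {P : O.Surface} {x y : I} (hx : x ≠ 1) (hy : y ≠ 1)
    (h : O.proj P = (((x : ℝ) : UnitAddCircle), ((y : ℝ) : UnitAddCircle))) :
    ∃ s, P = O.pt s x y := by
  obtain ⟨s, x', y', hx', hy', rfl⟩ := O.exists_pt P
  rw [proj_pt, Prod.mk.injEq] at h
  exact ⟨s, by rw [eq_of_coe_unitAddCircle_eq hx hx' h.1, eq_of_coe_unitAddCircle_eq hy hy' h.2]⟩

/-- The permutation of the squares given by going once around the lower left corner. -/
def vertexPerm : Equiv.Perm S := O.up * O.right * O.up⁻¹ * O.right⁻¹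

theorem vertexPerm_right_up (s : S) : O.vertexPerm (O.right (O.up s)) = O.up (O.right s) := by
  simp [vertexPerm]

theorem pt_vertexPerm (s : S) : O.pt (O.vertexPerm s) 0 0 = O.pt s 0 0 := by
  obtain ⟨s, rfl⟩ := O.right.surjective s
  obtain ⟨s, rfl⟩ := O.up.surjective s
  rw [vertexPerm_right_up, ← pt_one_right, ← pt_one_left, pt_one_right, pt_one_left]

theorem pt_zero_of_sameCycle {s t : S} (h : O.vertexPerm.SameCycle s t) :
    O.pt s 0 0 = O.pt t 0 0 := by
  obtain ⟨j, rfl⟩ := h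
  induction j with
  | zero => rfl
  | succ j ih => rw [add_comm, zpow_one_add, Equiv.Perm.mul_apply, pt_vertexPerm, ih]
  | pred j ih =>
    rw [ih, ← O.pt_vertexPerm ((O.vertexPerm ^ (-(j : ℤ) - 1)) s), ← Equiv.Perm.mul_apply,
      ← zpow_one_add, add_sub_cancel]

/-- A function on the surface, given by functions on the unit squares that respect the side
identifications. -/
def lift {A : Type*} (F : S → I → I → A) (hright : ∀ s t, F s 1 t = F (O.right s) 0 t)
    (hup : ∀ s t, F s t 1 = F (O.up s) t 0) : O.Surface → A :=
  Quot.lift (fun p => F p.1 p.2.1 p.2.2) fun _ _ h => by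
    cases h with
    | right s t => exact hright s t
    | up s t => exact hup s t

theorem lift_pt {A : Type*} (F : S → I → I → A) (hright : ∀ s t, F s 1 t = F (O.right s) 0 t)
    (hup : ∀ s t, F s t 1 = F (O.up s) t 0) (s : S) (x y : I) :
    O.lift F hright hup (O.pt s x y) = F s x y := rfl

theorem continuous_lift {A : Type*} [TopologicalSpace A] (F : S → I → I → A)
    (hright : ∀ s t, F s 1 t = F (O.right s) 0 t) (hup : ∀ s t, F s t 1 = F (O.up s) t 0)
    (hF : ∀ s, Continuous fun z : I × I => F s z.1 z.2) : Continuous (O.lift F hright hup) :=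
  continuous_quot_lift _ (continuous_sigma_iff.2 hF)

/-- The function on the surface that interpolates prescribed values at the vertices; the value at
the lower left corner of the square `s` is `w s`. -/
noncomputable def vertexBump (w : S → ℝ) (hw : ∀ s, w (O.vertexPerm s) = w s) : O.Surface → ℝ :=
  O.lift (fun s x y => (1 - y) * ((1 - x) * w s + x * w (O.right s)) +
      y * ((1 - x) * w (O.up s) + x * w (O.up (O.right s))))
    (fun s t => by simp) (fun s t => by simp [← vertexPerm_right_up, hw])

/-- A sum of bumps supported around the left sides of the squares, with prescribed heights. -/
noncomputable def leftSideBump (a : S → ℝ) : O.Surface → ℝ :=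
  O.lift (fun s x y => y * (1 - y) * ((1 - x) * a s + x * a (O.right s)))
    (fun s t => by simp) (fun s t => by simp)

/-- A sum of bumps supported around the lower sides of the squares, with prescribed heights. -/
noncomputable def lowerSideBump (a : S → ℝ) : O.Surface → ℝ :=
  O.lift (fun s x y => x * (1 - x) * ((1 - y) * a s + y * a (O.up s)))
    (fun s t => by simp) (fun s t => by simp)

/-- A sum of bumps supported in the squares, with prescribed heights. -/
noncomputable def squareBump (a : S → ℝ) : O.Surface → ℝ :=
  O.lift (fun s x y => x * (1 - x) * (y * (1 - y)) * a s) (fun s t => by simp) (fun s t => by simp)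

theorem continuous_vertexBump (w : S → ℝ) (hw : ∀ s, w (O.vertexPerm s) = w s) :
    Continuous (O.vertexBump w hw) :=
  O.continuous_lift _ _ _ fun s => by fun_prop

theorem continuous_leftSideBump (a : S → ℝ) : Continuous (O.leftSideBump a) :=
  O.continuous_lift _ _ _ fun s => by fun_prop

theorem continuous_lowerSideBump (a : S → ℝ) : Continuous (O.lowerSideBump a) :=
  O.continuous_lift _ _ _ fun s => by fun_prop

theorem continuous_squareBump (a : S → ℝ) : Continuous (O.squareBump a) :=
  O.continuous_lift _ _ _ fun s => by fun_prop

theorem coe_mul_one_sub_pos {x : I} (h0 : x ≠ 0) (h1 : x ≠ 1) : 0 < (x : ℝ) * (1 - x) :=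
  mul_pos (unitInterval.pos_iff_ne_zero.2 h0) (sub_pos.2 (unitInterval.lt_one_iff_ne_one.2 h1))

theorem squareBump_pt_ne_zero_iff {a : S → ℝ} {s : S} {x y : I} (hx0 : x ≠ 0) (hx : x ≠ 1)
    (hy0 : y ≠ 0) (hy : y ≠ 1) : O.squareBump a (O.pt s x y) ≠ 0 ↔ a s ≠ 0 := by
  have hpos := mul_pos (coe_mul_one_sub_pos hx0 hx) (coe_mul_one_sub_pos hy0 hy)
  rw [squareBump, lift_pt, mul_ne_zero_iff, and_iff_right hpos.ne']

/-- Distinct points of the surface over the same point of the torus are separated by a continuous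
real function. -/
theorem exists_continuous_ne {s t : S} {x y : I} (hx : x ≠ 1) (hy : y ≠ 1) (hst : s ≠ t)
    (h0 : x = 0 → y = 0 → ¬ O.vertexPerm.SameCycle s t) :
    ∃ F : O.Surface → ℝ, Continuous F ∧ F (O.pt s x y) ≠ F (O.pt t x y) := by
  classical
  by_cases hx0 : x = 0 <;> by_cases hy0 : y = 0
  · refine ⟨_, O.continuous_vertexBump (fun t => if O.vertexPerm.SameCycle s t then 1 else 0)
      fun t => by simp only [Equiv.Perm.sameCycle_apply_right], ?_⟩
    simp [vertexBump, lift_pt, hx0, hy0, h0 hx0 hy0, Equiv.Perm.SameCycle.refl]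
  · refine ⟨_, O.continuous_leftSideBump (Pi.single s 1), ?_⟩
    simpa [leftSideBump, lift_pt, hx0, hst.symm] using (coe_mul_one_sub_pos hy0 hy).ne'
  · refine ⟨_, O.continuous_lowerSideBump (Pi.single s 1), ?_⟩
    simpa [lowerSideBump, lift_pt, hy0, hst.symm] using (coe_mul_one_sub_pos hx0 hx).ne'
  · refine ⟨_, O.continuous_squareBump (Pi.single s 1), fun h => ?_⟩
    have hs : O.squareBump (Pi.single s 1) (O.pt s x y) ≠ 0 :=
      (O.squareBump_pt_ne_zero_iff hx0 hx hy0 hy).2 (by simp)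
    rw [h, O.squareBump_pt_ne_zero_iff hx0 hx hy0 hy, Pi.single_eq_of_ne hst.symm] at hs
    exact hs rfl

theorem pt_injective {s t : S} {x y : I} (hx : x ≠ 1) (hy : y ≠ 1) (h0 : ¬ (x = 0 ∧ y = 0))
    (h : O.pt s x y = O.pt t x y) : s = t := by
  by_contra hst
  obtain ⟨F, -, hF⟩ := O.exists_continuous_ne hx hy hst fun h1 h2 => absurd ⟨h1, h2⟩ h0
  exact hF (congrArg F h)

theorem pt_zero_eq_iff {s t : S} : O.pt s 0 0 = O.pt t 0 0 ↔ O.vertexPerm.SameCycle s t := by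
  refine ⟨fun h => ?_, O.pt_zero_of_sameCycle⟩
  by_contra hst
  obtain ⟨F, -, hF⟩ := O.exists_continuous_ne (s := s) (t := t) zero_ne_one zero_ne_one
    (fun h => hst (h ▸ Equiv.Perm.SameCycle.refl _ _)) fun _ _ => hst
  exact hF (congrArg F h)

instance : T2Space O.Surface := by
  refine ⟨fun P Q hPQ => ?_⟩
  by_cases hproj : O.proj P = O.proj Q
  · obtain ⟨s, x, y, hx, hy, rfl⟩ := O.exists_pt P
    obtain ⟨t, rfl⟩ := O.exists_pt_of_proj hx hy (hproj.symm.trans (O.proj_pt s x y))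
    obtain ⟨F, hF, hne⟩ := O.exists_continuous_ne hx hy (s := s) (t := t)
      (fun h => hPQ (h ▸ rfl)) fun hx0 hy0 h => hPQ (by rw [hx0, hy0, O.pt_zero_of_sameCycle h])
    exact separated_by_continuous hF hne
  · exact separated_by_continuous O.continuous_proj hproj

/-- The open unit square, as a subset of the closed one. -/
def openSquare : Set (I × I) := Set.Ioo 0 1 ×ˢ Set.Ioo 0 1

theorem isPreconnected_openSquare : IsPreconnected openSquare :=
  isPreconnected_Ioo.prod isPreconnected_Ioo

theorem closure_openSquare : closure openSquare = Set.univ := by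
  rw [openSquare, closure_prod_eq, closure_Ioo zero_ne_one]
  exact Set.eq_univ_of_forall fun z =>
    ⟨⟨unitInterval.nonneg', unitInterval.le_one'⟩, unitInterval.nonneg', unitInterval.le_one'⟩

theorem ne_of_mem_openSquare {z : I × I} (hz : z ∈ openSquare) :
    (z.1 ≠ 0 ∧ z.1 ≠ 1) ∧ z.2 ≠ 0 ∧ z.2 ≠ 1 :=
  ⟨⟨hz.1.1.ne', hz.1.2.ne⟩, hz.2.1.ne', hz.2.2.ne⟩

/-- Over the open unit square the surface is the disjoint union of the open squares, and this
locates the whole closed square by continuity. -/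
theorem exists_forall_eq_pt {g : I × I → O.Surface} {ζ : I × I → I × I} (hg : Continuous g)
    (hζ : Continuous ζ) (hmem : ∀ z ∈ openSquare, ζ z ∈ openSquare)
    (hproj : ∀ z ∈ openSquare, O.proj (g z) =
      ((((ζ z).1 : ℝ) : UnitAddCircle), (((ζ z).2 : ℝ) : UnitAddCircle))) :
    ∃ s, ∀ z, g z = O.pt s (ζ z).1 (ζ z).2 := by
  classical
  have hne (z : openSquare) := ne_of_mem_openSquare (hmem z z.2)
  choose idx hidx using fun z : openSquare =>
    O.exists_pt_of_proj (hne z).1.2 (hne z).2.2 (hproj z z.2)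
  have hconst : IsLocallyConstant idx := by
    refine (IsLocallyConstant.iff_eventually_eq _).2 fun z => ?_
    let F : openSquare → ℝ := fun z' => O.squareBump (Pi.single (idx z) 1) (g z')
    have hF : Continuous F :=
      (O.continuous_squareBump _).comp (hg.comp continuous_subtype_val)
    have hF_ne (z') : F z' ≠ 0 ↔ (Pi.single (idx z) 1 : S → ℝ) (idx z') ≠ 0 := by
      rw [← O.squareBump_pt_ne_zero_iff (hne z').1.1 (hne z').1.2 (hne z').2.1 (hne z').2.2,
        ← hidx]
    filter_upwards [hF.continuousAt.eventually_ne ((hF_ne z).2 (by simp))] with z' hz'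
    by_contra h
    exact (hF_ne z').1 hz' (Pi.single_eq_of_ne h 1)
  have : PreconnectedSpace openSquare :=
    isPreconnected_iff_preconnectedSpace.1 isPreconnected_openSquare
  obtain ⟨z₀, hz₀⟩ : openSquare.Nonempty := by
    rw [← closure_nonempty_iff, closure_openSquare]
    exact Set.univ_nonempty
  have hclosed : IsClosed {z | g z = O.pt (idx ⟨z₀, hz₀⟩) (ζ z).1 (ζ z).2} :=
    isClosed_eq hg ((O.continuous_pt _).comp hζ)
  refine ⟨idx ⟨z₀, hz₀⟩, fun z => hclosed.closure_subset_iff.2 (fun w hw => ?_)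
    (closure_openSquare ▸ Set.mem_univ z)⟩
  exact hconst.apply_eq_of_preconnectedSpace ⟨w, hw⟩ ⟨z₀, hz₀⟩ ▸ hidx ⟨w, hw⟩

end Origami

/-! ### Translations and deck transformations -/

namespace Origami

open unitInterval

variable {S : Type u} (O : Origami S)

theorem eq_of_forall_right_up {A : Sort*} (φ : S → A) (hright : ∀ s, φ (O.right s) = φ s)
    (hup : ∀ s, φ (O.up s) = φ s) (s t : S) : φ s = φ t := by
  obtain ⟨γ, hγ, rfl⟩ := O.connected s t
  suffices ∀ s, φ (γ s) = φ s from (this s).symm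
  induction hγ using Subgroup.closure_induction with
  | mem γ h =>
    obtain rfl | rfl := h
    exacts [hright, hup]
  | one => exact fun _ => rfl
  | mul γ γ' _ _ h h' => exact fun s => (h (γ' s)).trans (h' s)
  | inv γ _ h =>
    intro s
    rw [← h, ← Equiv.Perm.mul_apply, mul_inv_cancel, Equiv.Perm.one_apply]

theorem apply_eq_of_isLocallyConstant {A : Type*} {g : O.Surface → A} (hg : IsLocallyConstant g)
    (P Q : O.Surface) : g P = g Q := by
  have hsquare (s x y x' y') : g (O.pt s x y) = g (O.pt s x' y') :=
    (hg.comp_continuous (O.continuous_pt s)).apply_eq_of_preconnectedSpace (x, y) (x', y')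
  obtain ⟨s, x, y, -, -, rfl⟩ := O.exists_pt P
  obtain ⟨t, x', y', -, -, rfl⟩ := O.exists_pt Q
  rw [hsquare s x y 0 0, hsquare t x' y' 0 0]
  exact O.eq_of_forall_right_up (fun s => g (O.pt s 0 0))
    (fun s => by rw [← pt_one_left, hsquare s 1 0 0 0])
    (fun s => by rw [← pt_one_right, hsquare s 0 1 0 0]) s t

/-- The midpoint of the unit interval. -/
noncomputable def half : I := ⟨1 / 2, by norm_num, by norm_num⟩

theorem half_ne_zero : half ≠ 0 :=
  unitInterval.coe_ne_zero.1 (one_div_ne_zero two_ne_zero)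

theorem half_ne_one : half ≠ 1 :=
  unitInterval.coe_ne_one.1 one_half_lt_one.ne

theorem pt_half_injective {s t : S} (h : O.pt s half half = O.pt t half half) : s = t :=
  O.pt_injective half_ne_one half_ne_one (fun h => half_ne_zero h.1) h

theorem convexComb_one_mem_Ioo {x z : I} (hx : x ≠ 1) (hz : z ∈ Set.Ioo 0 1) :
    Set.Icc.convexComb x 1 z ∈ Set.Ioo (0 : I) 1 := by
  have hx' : (x : ℝ) < 1 := unitInterval.lt_one_iff_ne_one.2 hx
  have hz0 : (0 : ℝ) < z := hz.1
  have hz1 : (z : ℝ) < 1 := hz.2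
  rw [Set.mem_Ioo, ← Subtype.coe_lt_coe, ← Subtype.coe_lt_coe, Set.Icc.coe_convexComb]
  constructor <;> push_cast <;> nlinarith [x.2.1]

/-- A map that translates by `(x, y)` carries the lower left part of size `(1 - x) × (1 - y)` of
each square onto the upper right part of another one. -/
theorem exists_forall_apply_pt_eq {f : O.Surface → O.Surface} (hf : Continuous f) {x y : I}
    (hx : x ≠ 1) (hy : y ≠ 1) (hproj : ∀ R, O.proj (f R) =
      O.proj R + (((x : ℝ) : UnitAddCircle), ((y : ℝ) : UnitAddCircle))) (s : S) :
    ∃ t, ∀ z : I × I, f (O.pt s (σ x * z.1) (σ y * z.2)) =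
      O.pt t (Set.Icc.convexComb x 1 z.1) (Set.Icc.convexComb y 1 z.2) := by
  have hcoe (c r : I) : ((Set.Icc.convexComb c 1 r : I) : ℝ) = (σ c * r : I) + c := by
    push_cast [Set.Icc.coe_convexComb, unitInterval.coe_symm_eq]
    ring
  refine O.exists_forall_eq_pt (g := fun z => f (O.pt s (σ x * z.1) (σ y * z.2)))
    (ζ := fun z => (Set.Icc.convexComb x 1 z.1, Set.Icc.convexComb y 1 z.2))
    (hf.comp ((O.continuous_pt s).comp
      (by fun_prop : Continuous fun z : I × I => (σ x * z.1, σ y * z.2))))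
    (((Set.Icc.continuous_convexComb x 1).comp continuous_fst).prodMk
      ((Set.Icc.continuous_convexComb y 1).comp continuous_snd))
    (fun z hz => ⟨convexComb_one_mem_Ioo hx hz.1, convexComb_one_mem_Ioo hy hz.2⟩) fun z _ => ?_
  simp only [hproj, proj_pt, hcoe, AddCircle.coe_add, Prod.mk_add_mk]

theorem exists_map_of_deck {f : O.Surface → O.Surface} (hf : Continuous f)
    (hproj : ∀ R, O.proj (f R) = O.proj R) :
    ∃ τ : S → S, ∀ s x y, f (O.pt s x y) = O.pt (τ s) x y := by
  choose τ hτ using O.exists_forall_apply_pt_eq (x := 0) (y := 0) hf zero_ne_one zero_ne_one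
    (fun R => (hproj R).trans (by simp))
  refine ⟨τ, fun s x y => ?_⟩
  simpa only [symm_zero, one_mul, Set.Icc.convexComb_zero_one] using hτ s (x, y)

/-- The group of permutations of the squares that are compatible with the side identifications. -/
def autGroup : Subgroup (Equiv.Perm S) := Subgroup.centralizer {O.right, O.up}

variable {O} in
theorem mem_autGroup {τ : Equiv.Perm S} :
    τ ∈ O.autGroup ↔ (∀ s, τ (O.right s) = O.right (τ s)) ∧ ∀ s, τ (O.up s) = O.up (τ s) := by
  simp only [autGroup, Subgroup.mem_centralizer_iff, Set.mem_insert_iff, Set.mem_singleton_iff,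
    forall_eq_or_imp, forall_eq]
  simp only [Equiv.ext_iff, Equiv.Perm.mul_apply, eq_comm]

/-- The map of the surface that moves the square `s` to the square `τ s`. -/
def autMap (τ : O.autGroup) : O.Surface → O.Surface :=
  O.lift (fun s x y => O.pt (τ.1 s) x y)
    (fun s t => by rw [pt_one_left, (mem_autGroup.1 τ.2).1])
    (fun s t => by rw [pt_one_right, (mem_autGroup.1 τ.2).2])

theorem continuous_autMap (τ : O.autGroup) : Continuous (O.autMap τ) :=
  O.continuous_lift _ _ _ fun s => O.continuous_pt (τ.1 s)

theorem autMap_autMap (τ τ' : O.autGroup) (P : O.Surface) :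
    O.autMap τ (O.autMap τ' P) = O.autMap (τ * τ') P := by
  obtain ⟨s, x, y, -, -, rfl⟩ := O.exists_pt P
  rfl

theorem autMap_one (P : O.Surface) : O.autMap 1 P = P := by
  obtain ⟨s, x, y, -, -, rfl⟩ := O.exists_pt P
  rfl

/-- The action of the compatible permutations of the squares on the surface. -/
def autHom : O.autGroup →* (O.Surface ≃ₜ O.Surface) where
  toFun τ :=
    { toFun := O.autMap τ
      invFun := O.autMap τ⁻¹
      left_inv P := by rw [autMap_autMap, inv_mul_cancel, autMap_one]
      right_inv P := by rw [autMap_autMap, mul_inv_cancel, autMap_one]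
      continuous_toFun := O.continuous_autMap τ
      continuous_invFun := O.continuous_autMap τ⁻¹ }
  map_one' := Homeomorph.ext O.autMap_one
  map_mul' τ τ' := Homeomorph.ext fun P => (O.autMap_autMap τ τ' P).symm

theorem autHom_pt (τ : O.autGroup) (s : S) (x y : I) :
    O.autHom τ (O.pt s x y) = O.pt (τ.1 s) x y := rfl

theorem proj_autHom (τ : O.autGroup) (P : O.Surface) : O.proj (O.autHom τ P) = O.proj P := by
  obtain ⟨s, x, y, -, -, rfl⟩ := O.exists_pt P
  rfl

theorem autHom_injective : Function.Injective O.autHom := fun _ _ h =>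
  Subtype.ext <| Equiv.ext fun s =>
    O.pt_half_injective (DFunLike.congr_fun h (O.pt s half half))

theorem exists_autHom_eq_of_deck (f : O.Surface ≃ₜ O.Surface)
    (hproj : ∀ R, O.proj (f R) = O.proj R) : ∃ τ, O.autHom τ = f := by
  obtain ⟨τ, hτ⟩ := O.exists_map_of_deck f.continuous hproj
  obtain ⟨τ', hτ'⟩ := O.exists_map_of_deck f.symm.continuous fun R => by
    rw [← hproj, f.apply_symm_apply]
  let e : Equiv.Perm S :=
    { toFun := τ
      invFun := τ'
      left_inv s := O.pt_half_injective (by rw [← hτ', ← hτ, f.symm_apply_apply])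
      right_inv s := O.pt_half_injective (by rw [← hτ, ← hτ', f.apply_symm_apply]) }
  have hright (s : S) : τ (O.right s) = O.right (τ s) :=
    O.pt_injective (x := 0) (y := half) zero_ne_one half_ne_one (fun h => half_ne_zero h.2)
      (by rw [← hτ, ← pt_one_left, ← pt_one_left, hτ])
  have hup (s : S) : τ (O.up s) = O.up (τ s) :=
    O.pt_injective (x := half) (y := 0) half_ne_one zero_ne_one (fun h => half_ne_zero h.1)
      (by rw [← hτ, ← pt_one_right, ← pt_one_right, hτ])
  refine ⟨⟨e, mem_autGroup.2 ⟨hright, hup⟩⟩, Homeomorph.ext fun P => ?_⟩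
  obtain ⟨s, x, y, -, -, rfl⟩ := O.exists_pt P
  exact (hτ s x y).symm

/-- A translation that is not a deck transformation maps the vertex that two squares `s` and `s'`
share to a regular point, near which it cannot be injective. -/
theorem proj_eq_of_mem_trans {s s' : S} (hss' : s ≠ s') (hpt : O.pt s 0 0 = O.pt s' 0 0)
    {f : O.Surface ≃ₜ O.Surface} (hf : f ∈ O.trans) (R : O.Surface) : O.proj (f R) = O.proj R := by
  obtain ⟨t₀, x, y, hx, hy, hP⟩ := O.exists_pt (f (O.pt s 0 0))
  have htrans (R) :
      O.proj (f R) = O.proj R + (((x : ℝ) : UnitAddCircle), ((y : ℝ) : UnitAddCircle)) := by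
    rw [← sub_eq_iff_eq_add', O.apply_eq_of_isLocallyConstant hf R (O.pt s 0 0), hP]
    simp [proj_pt]
  by_cases hxy : x = 0 ∧ y = 0
  · simpa [hxy.1, hxy.2, ← Prod.zero_eq_mk] using htrans R
  have hmap := O.exists_forall_apply_pt_eq f.continuous hx hy htrans
  obtain ⟨t, ht⟩ := hmap s
  obtain ⟨t', ht'⟩ := hmap s'
  have htt' : t = t' := by
    have h := ht (0, 0)
    have h' := ht' (0, 0)
    simp only [mul_zero, Set.Icc.convexComb_zero] at h h'
    exact O.pt_injective hx hy hxy (by rw [← h, ← h', hpt])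
  have hne {c : I} (hc : c ≠ 1) : σ c * half ≠ 0 ∧ σ c * half ≠ 1 :=
    ⟨mul_ne_zero (unitInterval.symm_eq_zero.not.2 hc) half_ne_zero, ne_of_lt <|
      unitInterval.mul_le_right.trans_lt (unitInterval.lt_one_iff_ne_one.2 half_ne_one)⟩
  refine absurd (O.pt_injective (hne hx).2 (hne hy).2 (fun h => (hne hx).1 h.1) ?_) hss'
  exact f.injective ((ht (half, half)).trans (htt' ▸ (ht' (half, half)).symm))

theorem nonempty_autGroup_mulEquiv_trans {s s' : S} (hss' : s ≠ s')
    (hpt : O.pt s 0 0 = O.pt s' 0 0) : Nonempty (O.autGroup ≃* O.trans) := by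
  have h : O.autHom.range = O.trans := by
    refine SetLike.ext fun f => ⟨?_, fun hf =>
      O.exists_autHom_eq_of_deck f (O.proj_eq_of_mem_trans hss' hpt hf)⟩
    rintro ⟨τ, rfl⟩
    change IsLocallyConstant fun P => O.proj (O.autHom τ P) - O.proj P
    simp only [proj_autHom, sub_self]
    exact IsLocallyConstant.const 0
  exact ⟨(MonoidHom.ofInjective O.autHom_injective).trans (MulEquiv.subgroupCongr h)⟩

theorem isRegular_iff : O.IsRegular ↔ ∀ s t : S, ∃ τ ∈ O.autGroup, τ s = t := by
  refine ⟨fun h s t => ?_, fun h P Q hPQ => ?_⟩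
  · obtain ⟨f, hf, hst⟩ := h (O.pt s half half) (O.pt t half half) rfl
    obtain ⟨τ, rfl⟩ := O.exists_autHom_eq_of_deck f hf
    exact ⟨τ.1, τ.2, O.pt_half_injective hst⟩
  · obtain ⟨s, x, y, hx, hy, rfl⟩ := O.exists_pt P
    obtain ⟨t, rfl⟩ := O.exists_pt_of_proj hx hy (hPQ.symm.trans (O.proj_pt s x y))
    obtain ⟨τ, hτ, rfl⟩ := h s t
    exact ⟨O.autHom ⟨τ, hτ⟩, O.proj_autHom _, O.autHom_pt _ _ _ _⟩

end Origami

/-! ### Cone angles and strata -/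

theorem card_eq_ncard_range_mul {S A : Type*} [Finite S] {f : S → A} {n : ℕ}
    (hn : ∀ s, {t | f t = f s}.ncard = n) : Nat.card S = (Set.range f).ncard * n := by
  have : Fintype (Set.range f) := Fintype.ofFinite _
  have hfiber (P : Set.range f) : Nat.card {t // Set.rangeFactorization f t = P} = n := by
    obtain ⟨_, s, rfl⟩ := P
    rw [← hn s, ← Nat.card_coe_set_eq]
    exact Nat.card_congr (Equiv.subtypeEquivRight fun t => Subtype.ext_iff)
  rw [← Nat.card_congr (Equiv.sigmaFiberEquiv (Set.rangeFactorization f)), Nat.card_sigma,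
    Finset.sum_congr rfl fun P _ => hfiber P, Finset.sum_const, Finset.card_univ,
    ← Nat.card_eq_fintype_card, Nat.card_coe_set_eq, smul_eq_mul]

namespace Origami

open unitInterval

variable {S : Type u} (O : Origami S)

theorem coords_of_pt_eq {s t : S} {x y x' y' : I} (hx : x ≠ 1) (hy : y ≠ 1)
    (h : O.pt t x' y' = O.pt s x y) :
    (x' = x ∨ (x' = 1 ∧ x = 0)) ∧ (y' = y ∨ (y' = 1 ∧ y = 0)) := by
  have hproj := congrArg O.proj h
  rw [proj_pt, proj_pt, Prod.mk.injEq] at hproj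
  exact ⟨eq_or_of_coe_unitAddCircle_eq hx hproj.1, eq_or_of_coe_unitAddCircle_eq hy hproj.2⟩

theorem fiber_pt_left {s : S} {y : I} (hy0 : y ≠ 0) (hy : y ≠ 1) :
    {a : Squares S | Quot.mk O.Glue a = O.pt s 0 y} = {⟨s, (0, y)⟩, ⟨O.right⁻¹ s, (1, y)⟩} := by
  refine Set.Subset.antisymm ?_ ?_
  · rintro ⟨t, x', y'⟩ (h : O.pt t x' y' = O.pt s 0 y)
    obtain ⟨hx', hy'⟩ := O.coords_of_pt_eq zero_ne_one hy h
    obtain rfl : y' = y := hy'.resolve_right fun h => hy0 h.2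
    obtain rfl | ⟨rfl, -⟩ := hx'
    · exact Or.inl (by rw [O.pt_injective zero_ne_one hy (fun h => hy0 h.2) h])
    · rw [pt_one_left] at h
      exact Or.inr (by simp [← O.pt_injective zero_ne_one hy (fun h => hy0 h.2) h])
  · rintro _ (rfl | rfl)
    · rfl
    · exact (O.pt_one_left _ _).trans (by simp)

theorem fiber_pt_lower {s : S} {x : I} (hx0 : x ≠ 0) (hx : x ≠ 1) :
    {a : Squares S | Quot.mk O.Glue a = O.pt s x 0} = {⟨s, (x, 0)⟩, ⟨O.up⁻¹ s, (x, 1)⟩} := by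
  refine Set.Subset.antisymm ?_ ?_
  · rintro ⟨t, x', y'⟩ (h : O.pt t x' y' = O.pt s x 0)
    obtain ⟨hx', hy'⟩ := O.coords_of_pt_eq hx zero_ne_one h
    obtain rfl : x' = x := hx'.resolve_right fun h => hx0 h.2
    obtain rfl | ⟨rfl, -⟩ := hy'
    · exact Or.inl (by rw [O.pt_injective hx zero_ne_one (fun h => hx0 h.1) h])
    · rw [pt_one_right] at h
      exact Or.inr (by simp [← O.pt_injective hx zero_ne_one (fun h => hx0 h.1) h])
  · rintro _ (rfl | rfl)
    · rfl
    · exact (O.pt_one_right _ _).trans (by simp)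

theorem fiber_pt_interior {s : S} {x y : I} (hx0 : x ≠ 0) (hx : x ≠ 1) (hy0 : y ≠ 0)
    (hy : y ≠ 1) : {a : Squares S | Quot.mk O.Glue a = O.pt s x y} = {⟨s, (x, y)⟩} := by
  refine Set.Subset.antisymm ?_ (Set.singleton_subset_iff.2 rfl)
  rintro ⟨t, x', y'⟩ (h : O.pt t x' y' = O.pt s x y)
  obtain ⟨hx', hy'⟩ := O.coords_of_pt_eq hx hy h
  obtain rfl : x' = x := hx'.resolve_right fun h => hx0 h.2
  obtain rfl : y' = y := hy'.resolve_right fun h => hy0 h.2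
  rw [O.pt_injective hx hy (fun h => hx0 h.1) h, Set.mem_singleton_iff]

theorem coneAngle_pt_of_ne_zero {s : S} {x y : I} (hx : x ≠ 1) (hy : y ≠ 1)
    (h0 : ¬ (x = 0 ∧ y = 0)) : O.coneAngle (O.pt s x y) = 2 * Real.pi := by
  rw [coneAngle]
  by_cases hx0 : x = 0
  · have hy0 : y ≠ 0 := fun hy0 => h0 ⟨hx0, hy0⟩
    rw [hx0, O.fiber_pt_left hy0 hy, finsum_mem_pair (by simp)]
    norm_num [squareAngle, hy0, hy, ← mul_add]
  by_cases hy0 : y = 0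
  · rw [hy0, O.fiber_pt_lower hx0 hx, finsum_mem_pair (by simp)]
    norm_num [squareAngle, hx0, hx, ← mul_add]
  · rw [O.fiber_pt_interior hx0 hx hy0 hy, finsum_mem_singleton]
    simp [squareAngle, hx0, hx, hy0, hy]

/-- The corner of a square that lies at the lower left corner of the square `t`: the lower or upper,
left or right corner according to the Boolean values. -/
def corner : S × Bool × Bool → Squares S
  | (t, false, false) => ⟨t, (0, 0)⟩
  | (t, true, false) => ⟨O.right⁻¹ t, (1, 0)⟩
  | (t, false, true) => ⟨O.up⁻¹ t, (0, 1)⟩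
  | (t, true, true) => ⟨O.right⁻¹ (O.up⁻¹ t), (1, 1)⟩

theorem mk_corner (t : S) (b : Bool × Bool) : Quot.mk O.Glue (O.corner (t, b)) = O.pt t 0 0 := by
  rcases b with ⟨_ | _, _ | _⟩
  · rfl
  · exact (O.pt_one_right _ _).trans (by simp)
  · exact (O.pt_one_left _ _).trans (by simp)
  · exact (O.pt_one_left _ _).trans ((O.pt_one_right _ _).trans (by simp))

theorem corner_injective : Function.Injective O.corner := by
  rintro ⟨t, _ | _, _ | _⟩ ⟨t', _ | _, _ | _⟩ h <;> simp_all [corner]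

theorem exists_corner_eq {t : S} {x y : I} (hx : x = 0 ∨ x = 1) (hy : y = 0 ∨ y = 1) :
    ∃ p, O.corner p = ⟨t, (x, y)⟩ := by
  rcases hx with rfl | rfl <;> rcases hy with rfl | rfl
  · exact ⟨(t, false, false), rfl⟩
  · exact ⟨(O.up t, false, true), by simp [corner]⟩
  · exact ⟨(O.right t, true, false), by simp [corner]⟩
  · exact ⟨(O.up (O.right t), true, true), by simp [corner]⟩

theorem squareAngle_corner (p : S × Bool × Bool) :
    squareAngle (O.corner p).2 = 2 * Real.pi * (1 / 4) := by
  rcases p with ⟨t, _ | _, _ | _⟩ <;> norm_num [corner, squareAngle, mul_assoc]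

theorem fiber_vertex (s : S) : {a : Squares S | Quot.mk O.Glue a = O.pt s 0 0} =
    O.corner '' ({t | O.pt t 0 0 = O.pt s 0 0} ×ˢ Set.univ) := by
  refine Set.Subset.antisymm ?_ ?_
  · rintro ⟨t, x, y⟩ (h : O.pt t x y = O.pt s 0 0)
    obtain ⟨hx, hy⟩ := O.coords_of_pt_eq zero_ne_one zero_ne_one h
    obtain ⟨⟨t', b⟩, hp⟩ := O.exists_corner_eq (t := t) (x := x) (y := y)
      (hx.imp_right And.left) (hy.imp_right And.left)
    exact ⟨(t', b), ⟨(O.mk_corner t' b).symm.trans (hp ▸ h), Set.mem_univ _⟩, hp⟩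
  · rintro _ ⟨⟨t, b⟩, ⟨ht, -⟩, rfl⟩
    exact (O.mk_corner t b).trans ht

theorem coneAngle_vertex [Finite S] (s : S) :
    O.coneAngle (O.pt s 0 0) = 2 * Real.pi * {t | O.pt t 0 0 = O.pt s 0 0}.ncard := by
  rw [coneAngle, fiber_vertex, finsum_mem_image O.corner_injective.injOn]
  simp only [squareAngle_corner]
  rw [finsum_mem_eq_finite_toFinset_sum _ (Set.toFinite _), Finset.sum_const,
    ← Set.ncard_eq_toFinset_card, Set.ncard_prod, Set.ncard_univ, nsmul_eq_mul]
  simp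
  ring

theorem hasOrder_vertex_iff [Finite S] (s : S) (m : ℕ) :
    O.HasOrder (O.pt s 0 0) m ↔ {t | O.pt t 0 0 = O.pt s 0 0}.ncard = m + 1 := by
  rw [HasOrder, coneAngle_vertex, mul_right_inj' (by positivity)]
  exact_mod_cast Iff.rfl

theorem exists_vertex_of_not_hasOrder_zero {P : O.Surface} (h : ¬ O.HasOrder P 0) :
    ∃ s, P = O.pt s 0 0 := by
  obtain ⟨s, x, y, hx, hy, rfl⟩ := O.exists_pt P
  by_cases h0 : x = 0 ∧ y = 0
  · exact ⟨s, by rw [h0.1, h0.2]⟩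
  · exact absurd (by simp [HasOrder, O.coneAngle_pt_of_ne_zero hx hy h0]) h

theorem setOf_not_hasOrder_zero_eq_range [Finite S] {n : ℕ} (hn1 : n ≠ 1)
    (hn : ∀ s, {t | O.pt t 0 0 = O.pt s 0 0}.ncard = n) :
    {P | ¬ O.HasOrder P 0} = Set.range fun s => O.pt s 0 0 := by
  refine Set.Subset.antisymm (fun P hP => ?_) ?_
  · obtain ⟨s, rfl⟩ := O.exists_vertex_of_not_hasOrder_zero hP
    exact ⟨s, rfl⟩
  · rintro _ ⟨s, rfl⟩ h
    rw [hasOrder_vertex_iff, hn] at h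
    exact hn1 h

variable {O} in
theorem inStratum_iff_of_ncard [Finite S] {n k r : ℕ} (hk : k ≠ 0) (hr : r ≠ 0)
    (hn : ∀ s, {t | O.pt t 0 0 = O.pt s 0 0}.ncard = n) :
    O.InStratum k r ↔ n = k + 1 ∧ Nat.card S = r * (k + 1) := by
  have hcard := card_eq_ncard_range_mul hn
  constructor
  · rintro ⟨-, hzeros, hord⟩
    obtain ⟨P, hP⟩ : {P | ¬ O.HasOrder P 0}.Nonempty :=
      Set.nonempty_of_ncard_ne_zero (hzeros ▸ hr)
    have hPk := hord P hP
    obtain ⟨s, rfl⟩ := O.exists_vertex_of_not_hasOrder_zero hP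
    rw [hasOrder_vertex_iff, hn] at hPk
    rw [O.setOf_not_hasOrder_zero_eq_range (by lia) hn] at hzeros
    exact ⟨hPk, by rw [hcard, hzeros, hPk]⟩
  · rintro ⟨rfl, hS⟩
    rw [InStratum, O.setOf_not_hasOrder_zero_eq_range (by lia) hn]
    refine ⟨Set.finite_range _, Nat.eq_of_mul_eq_mul_right k.succ_pos (hcard ▸ hS), fun P hP => ?_⟩
    obtain ⟨s, rfl⟩ := O.exists_vertex_of_not_hasOrder_zero hP
    rw [hasOrder_vertex_iff, hn]

end Origami

/-! ### Regular origamis and groups with two generators -/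

namespace Origami

variable {S : Type u} (O : Origami S)

variable {O} in
theorem ncard_vertex_of_cayley {G : Type*} [Group G] {x y : G} (e : G ≃ S)
    (hx : ∀ g, O.right (e g) = e (g * x)) (hy : ∀ g, O.up (e g) = e (g * y)) (s : S) :
    {t | O.pt t 0 0 = O.pt s 0 0}.ncard = orderOf (x * y * x⁻¹ * y⁻¹) := by
  have hright : O.right = e.permCongrHom (Equiv.mulRight x) := Equiv.ext fun s => by
    simpa using hx (e.symm s)
  have hup : O.up = e.permCongrHom (Equiv.mulRight y) := Equiv.ext fun s => by
    simpa using hy (e.symm s)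
  set d := x⁻¹ * y⁻¹ * x * y with hd
  have hvertex : O.vertexPerm = e.permCongrHom (Equiv.mulRight d) := by
    simp only [vertexPerm, hright, hup, ← map_inv, ← map_mul, Equiv.inv_mulRight,
      ← Equiv.mulRight_mul, hd, mul_assoc]
  have hset : {t | O.pt t 0 0 = O.pt s 0 0} =
      (fun h => e (e.symm s * h)) '' (Subgroup.zpowers d : Set G) := by
    ext t
    rw [Set.mem_ofPred_eq, eq_comm, pt_zero_eq_iff, hvertex]
    simp only [Equiv.Perm.SameCycle, ← map_zpow, Equiv.zpow_mulRight]
    simp [Subgroup.mem_zpowers_iff]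
  have hord : orderOf d = orderOf (x * y * x⁻¹ * y⁻¹) := by
    rw [← (MulAut.conj (y * x)).orderOf_eq d, MulAut.conj_apply, hd]
    group
  rw [hset, Set.ncard_image_of_injective _ fun a b h => mul_left_cancel (e.injective h), ← hord,
    ← Nat.card_zpowers]
  rfl

theorem mulRight_mem_closure {G : Type*} [Group G] {x y g : G} (hg : g ∈ Subgroup.closure {x, y}) :
    Equiv.mulRight g ∈ Subgroup.closure {Equiv.mulRight x, Equiv.mulRight y} := by
  induction hg using Subgroup.closure_induction with
  | mem g h => exact Subgroup.subset_closure (by obtain rfl | rfl := h <;> simp)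
  | one => exact Equiv.mulRight_one (α := G) ▸ one_mem _
  | mul a b _ _ ha hb => exact Equiv.mulRight_mul a b ▸ mul_mem hb ha
  | inv a _ ha => exact Equiv.inv_mulRight a ▸ inv_mem ha

/-- The origami whose squares are the elements of a group with generators `x` and `y`; their
neighbours are the products with `x` and `y` from the right. -/
def ofGroup {G : Type u} [Group G] (x y : G) (h : Subgroup.closure {x, y} = ⊤) : Origami G where
  right := Equiv.mulRight x
  up := Equiv.mulRight y
  nonempty := ⟨1⟩
  connected s t := ⟨_, mulRight_mem_closure (h ▸ Subgroup.mem_top (s⁻¹ * t)),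
    mul_inv_cancel_left s t⟩

theorem isRegular_ofGroup {G : Type u} [Group G] (x y : G) (h : Subgroup.closure {x, y} = ⊤) :
    (ofGroup x y h).IsRegular :=
  (isRegular_iff _).2 fun s t => ⟨Equiv.mulLeft (t * s⁻¹),
    mem_autGroup.2 ⟨fun _ => (mul_assoc _ _ _).symm, fun _ => (mul_assoc _ _ _).symm⟩,
    inv_mul_cancel_right t s⟩

theorem inStratum_ofGroup {k q : ℕ} (hk : k ≠ 0) (hq : q ≠ 0) {G : Type u} [Group G] [Finite G]
    {x y : G} (h : IsAdmissible k q G x y) : (ofGroup x y h.2.1).InStratum k (2 * q) := by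
  refine (inStratum_iff_of_ncard hk (by lia) fun s => ?_).2 ⟨h.2.2, by rw [h.1]; ring⟩
  exact ncard_vertex_of_cayley (Equiv.refl G) (fun _ => rfl) (fun _ => rfl) s

theorem bijective_autGroup_apply (hO : O.IsRegular) (s₀ : S) :
    Function.Bijective fun τ : O.autGroup => τ.1 s₀ := by
  refine ⟨fun τ τ' h => Subtype.ext (Equiv.ext fun s => ?_), fun s => ?_⟩
  · have hτ := mem_autGroup.1 τ.2
    have hτ' := mem_autGroup.1 τ'.2
    refine (O.eq_of_forall_right_up (fun s => τ.1 s = τ'.1 s) (fun s => ?_) (fun s => ?_) s₀ s).mp h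
    · rw [hτ.1, hτ'.1, O.right.apply_eq_iff_eq]
    · rw [hτ.2, hτ'.2, O.up.apply_eq_iff_eq]
  · obtain ⟨τ, hτ, h⟩ := O.isRegular_iff.1 hO s₀ s
    exact ⟨⟨τ, hτ⟩, h⟩

/-- The squares of a regular origami are the elements of its group of compatible permutations, and
the moves to the right and up are products from the right with two generators. -/
theorem exists_cayley_of_isRegular (hO : O.IsRegular) :
    ∃ (x y : O.autGroup) (e : O.autGroup ≃ S), (∀ g, O.right (e g) = e (g * x)) ∧
      (∀ g, O.up (e g) = e (g * y)) ∧ Subgroup.closure {x, y} = ⊤ := by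
  obtain ⟨s₀⟩ := O.nonempty
  let e : O.autGroup ≃ S := Equiv.ofBijective _ (O.bijective_autGroup_apply hO s₀)
  obtain ⟨x, hx : x.1 s₀ = O.right s₀⟩ := e.surjective (O.right s₀)
  obtain ⟨y, hy : y.1 s₀ = O.up s₀⟩ := e.surjective (O.up s₀)
  have hright (g) : O.right (e g) = e (g * x) :=
    ((mem_autGroup.1 g.2).1 s₀).symm.trans (congrArg g.1 hx).symm
  have hup (g) : O.up (e g) = e (g * y) :=
    ((mem_autGroup.1 g.2).2 s₀).symm.trans (congrArg g.1 hy).symm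
  refine ⟨x, y, e, hright, hup, eq_top_iff.2 fun g _ => ?_⟩
  have hmk (z : O.autGroup) (hz : z ∈ ({x, y} : Set O.autGroup)) (h : O.autGroup) :
      ((h * z : O.autGroup) : O.autGroup ⧸ Subgroup.closure {x, y}) = h :=
    QuotientGroup.mk_mul_of_mem h (Subgroup.subset_closure hz)
  have hconst := O.eq_of_forall_right_up
    (fun s => (e.symm s : O.autGroup ⧸ Subgroup.closure {x, y}))
    (e.surjective.forall.2 fun h => by
      rw [hright, e.symm_apply_apply, e.symm_apply_apply, hmk x (by simp)])
    (e.surjective.forall.2 fun h => by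
      rw [hup, e.symm_apply_apply, e.symm_apply_apply, hmk y (by simp)]) (e 1) (e g)
  simpa [QuotientGroup.eq] using hconst

theorem exists_isAdmissible_trans [Finite S] {k q : ℕ} (hk : k ≠ 0) (hq : q ≠ 0)
    (hO : O.IsRegular) (hst : O.InStratum k (2 * q)) :
    ∃ x y : O.trans, IsAdmissible k q O.trans x y := by
  obtain ⟨x, y, e, hx, hy, hgen⟩ := O.exists_cayley_of_isRegular hO
  have hn := ncard_vertex_of_cayley e hx hy
  obtain ⟨hord, hcard⟩ := (inStratum_iff_of_ncard hk (by lia) hn).1 hst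
  have hadm : IsAdmissible k q O.autGroup x y :=
    ⟨by rw [Nat.card_congr e, hcard]; ring, hgen, hord⟩
  obtain ⟨s⟩ := O.nonempty
  obtain ⟨s', hs', hne⟩ := Set.exists_ne_of_one_lt_ncard (s := {t | O.pt t 0 0 = O.pt s 0 0})
    (by rw [hn s, hord]; lia) s
  obtain ⟨E⟩ := O.nonempty_autGroup_mulEquiv_trans hne hs'
  exact ⟨E x, E y, hadm.of_mulEquiv E⟩

end Origami

theorem IsAdmissible.arithCondition {k q : ℕ} {G : Type*} [Group G] {x y : G} (hk : Odd k)
    (hq : q.Prime) (hq2 : q ≠ 2) (h : IsAdmissible k q G x y) : ArithCondition k q := by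
  obtain ⟨hq3, h⟩ := h.eq_three_and_type hk hq hq2
  exact ⟨hq3, h.imp (fun h => ⟨h.1, h.2.1⟩) fun h => ⟨h.1, h.2.1⟩⟩

theorem IsAdmissible.isKleinType_and_isQuaternionType {k q : ℕ} {G : Type*} [Group G] {x y : G}
    (hk : Odd k) (hq : q.Prime) (hq2 : q ≠ 2) (h : IsAdmissible k q G x y) :
    (k % 4 = 1 → IsKleinType ((k + 1) / 2) G) ∧
      (k % 4 = 3 → IsQuaternionType ((k + 1) / 4) G) := by
  obtain ⟨-, h | h⟩ := h.eq_three_and_type hk hq hq2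
  · exact ⟨fun _ => h.2.2, fun _ => by lia⟩
  · exact ⟨fun _ => by lia, fun _ => h.2.2⟩

theorem theorem6p9 (k q : ℕ) (hk : Odd k) (hq : q.Prime) (hq2 : q ≠ 2) :
    -- existence of regular origamis in `H(k ^ (2q))`, and their translation groups
    (((∃ (S : Type u) (_ : Finite S) (O : Origami S), O.IsRegular ∧ O.InStratum k (2 * q)) ↔
        ArithCondition k q) ∧
      ∀ (S : Type u) [Finite S] (O : Origami S), O.IsRegular → O.InStratum k (2 * q) →
        (k % 4 = 1 → IsKleinType ((k + 1) / 2) O.trans) ∧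
        (k % 4 = 3 → IsQuaternionType ((k + 1) / 4) O.trans)) ∧
    -- the same for the groups of order `2 (k + 1) q` with two generators
    (((∃ (G : Type u) (_ : Group G) (x y : G), IsAdmissible k q G x y) ↔
        ArithCondition k q) ∧
      ∀ (G : Type u) [Group G] (x y : G), IsAdmissible k q G x y →
        (k % 4 = 1 → IsKleinType ((k + 1) / 2) G) ∧
        (k % 4 = 3 → IsQuaternionType ((k + 1) / 4) G)) := by
  have hk0 : k ≠ 0 := hk.pos.ne'
  refine ⟨⟨⟨?_, fun h => ?_⟩, fun S _ O hO hst => ?_⟩,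
    ⟨fun ⟨G, _, x, y, h⟩ => h.arithCondition hk hq hq2, exists_isAdmissible_of_arithCondition⟩,
    fun G _ x y h => h.isKleinType_and_isQuaternionType hk hq hq2⟩
  · rintro ⟨S, _, O, hO, hst⟩
    obtain ⟨x, y, h⟩ := O.exists_isAdmissible_trans hk0 hq.ne_zero hO hst
    exact h.arithCondition hk hq hq2
  · obtain ⟨G, _, x, y, hG⟩ := exists_isAdmissible_of_arithCondition.{u} h
    have := hG.finite hq
    exact ⟨G, this, Origami.ofGroup x y hG.2.1, Origami.isRegular_ofGroup x y _,
      Origami.inStratum_ofGroup hk0 hq.ne_zero hG⟩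
  · obtain ⟨x, y, h⟩ := O.exists_isAdmissible_trans hk0 hq.ne_zero hO hst
    exact h.isKleinType_and_isQuaternionType hk hq hq2
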